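/- Let $d\in\{2,3\}$ and let $\Omega$ be either the torus $\mathbb T^d=[0,2\pi]^d$ or a nonempty bounded open subset of $\mathbb R^d$ (for instance a bounded domain with smooth boundary). Let $\alpha,\nu>0$ and $g\in L^2(\Omega)^d$, with $\int_\Omega g=0$ in the case of the torus. Let $\mathbf H^1$ be the Hilbert space of vector fields $u$ with $\operatorname{div}u=0$ that belong to $H^1_0(\Omega)^d$ if $\Omega$ is an open set, respectively to $H^1(\mathbb T^d)^d$ with zero mean if $\Omega=\mathbb T^d$. Write $(\cdot,\cdot)$ and $\|\cdot\|$ for the scalar product and norm of $L^2$, and $$(u,v)_\alpha=(u,v)+\alpha(\nabla u,\nabla v),\qquad \|u\|_\alpha=(u,u)_\alpha^{1/2}\qquad(u,v\in\mathbf H^1).$$ Let $A=-\Pi\Delta$ be the Stokes operator and $B(u,w)=\Pi((u,\nabla)w)$ the Navier--Stokes bilinear operator, where $\Pi$ is the Helmholtz--Leray projection; both are understood weakly, $\langle Au,v\rangle=(\nabla u,\nabla v)$ and $\langle B(u,w),v\rangle=((u,\nabla)w,v)$ for $v\in\mathbf H^1$, and $w=(1+\alpha A)^{-1}f$ is the element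 of $\mathbf H^1$ with $(w,v)_\alpha=\langle f,v\rangle$ for all $v\in\mathbf H^1$. On a time interval $I\subset[0,\infty)$ consider the Navier--Stokes--Voight equation $$\partial_t u+\nu A(1+\alpha A)^{-1}u+(1+\alpha A)^{-1}B(u,u)=(1+\alpha A)^{-1}g \qquad(\mathrm{NSV})$$ for differentiable $u:I\to\mathbf H^1$. Then the Stokes operator has a least eigenvalue $\lambda_1$, and $\lambda_1>0$. With $\gamma=\nu\lambda_1/(\alpha\lambda_1+1)$, every solution $u$ of (NSV) on an interval $[0,T]$, $T>0$, satisfies for all $t\in[0,T]$ $$\|u(t)\|_\alpha^2\le\|u(0)\|_\alpha^2e^{-\gamma t}+\frac{\alpha\lambda_1+1}{\nu^2\lambda_1^2}\|g\|^2\left(1-e^{-\gamma t}\right).$$ Moreover, for every $u_0\in\mathbf H^1$ there is a solution $u$ of (NSV) on $[0,\infty)$ with $u(0)=u_0$; any solution on an interval $[0,T]$ with the same initial value coincides with it on $[0,T]$; and the semigroup $S(t)u_0=u(t)$, $t\ge0$, so defined on $\mathbf H^1$ is dissipative: there is a bounded set $\mathcal B\subset\mathbf H^1$ such that for every bounded $C\subset\mathbf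 H^1$ there is $T\ge0$ with $S(t)C\subset\mathcal B$ for all $t\ge T$. -/

import Mathlib

open Set MeasureTheory
open scoped NNReal ENNReal ContDiff

noncomputable section

namespace NSV

/-- `ℝ^d` with its Euclidean norm. -/
abbrev Vec (d : ℕ) : Type := EuclideanSpace ℝ (Fin d)

/-- Values of gradients of vector fields, with the Frobenius inner product.  The entry with
index `(i, j)` is the partial derivative `∂_i u_j`. -/
abbrev Mat (d : ℕ) : Type := EuclideanSpace ℝ (Fin d × Fin d)

/-- The flow domain: the torus `𝕋^d = [0,2π]^d` (periodic boundary conditions and zero mean), or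
a nonempty bounded open set `Ω ⊂ ℝ^d` (Dirichlet boundary condition). -/
inductive FlowDomain (d : ℕ) : Type
  | torus : FlowDomain d
  | dirichlet (Ω : Set (Vec d)) (isOpen : IsOpen Ω) (isBounded : Bornology.IsBounded Ω)
      (nonempty : Ω.Nonempty) : FlowDomain d

/-- The gradient matrix `(∂_i φ_j)(x)` of a differentiable vector field. -/
def classicalGrad {d : ℕ} (φ : Vec d → Vec d) (x : Vec d) : Mat d :=
  WithLp.toLp 2 fun ij : Fin d × Fin d => fderiv ℝ φ x (EuclideanSpace.single ij.1 1) ij.2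

namespace FlowDomain

variable {d : ℕ} (D : FlowDomain d)

/-- The open set `Ω`, or the period cell of the torus. -/
def region : FlowDomain d → Set (Vec d)
  | torus => {x | ∀ i, x i ∈ Ico (0 : ℝ) (2 * Real.pi)}
  | dirichlet Ω _ _ _ => Ω

/-- Lebesgue measure on the flow domain. -/
def measure : Measure (Vec d) := volume.restrict D.region

/-- Smooth vector fields satisfying the side conditions: `2π`-periodic in each variable with zero
mean on the torus, compactly supported inside `Ω` in the Dirichlet case. -/
def IsTestField : FlowDomain d → (Vec d → Vec d) → Prop
  | torus, φ => ContDiff ℝ ∞ φ ∧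
      (∀ x i, φ (x + EuclideanSpace.single i (2 * Real.pi)) = φ x) ∧
      ∫ x, φ x ∂(torus : FlowDomain d).measure = 0
  | dirichlet Ω _ _ _, φ => ContDiff ℝ ∞ φ ∧ HasCompactSupport φ ∧ tsupport φ ⊆ Ω

/-- Square integrable vector fields on the flow domain. -/
abbrev L2 : Type := Lp (Vec d) 2 D.measure

/-- Pairs (vector field, gradient) in `L²`, with the `H¹` inner product
`(u, v) + (∇u, ∇v)`. -/
abbrev Pair : Type := WithLp 2 (D.L2 × Lp (Mat d) 2 D.measure)

/-- The Sobolev space `H¹₀(Ω)^d`, respectively `H¹(𝕋^d)^d` with zero mean, each element being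
recorded with its weak gradient: the closure in `H¹` of the smooth fields satisfying the side
conditions. -/
def sobolev : Submodule ℝ D.Pair :=
  (Submodule.span ℝ {w : D.Pair | ∃ φ : Vec d → Vec d, D.IsTestField φ ∧
    (w.fst : Vec d → Vec d) =ᵐ[D.measure] φ ∧
    (w.snd : Vec d → Mat d) =ᵐ[D.measure] classicalGrad φ}).topologicalClosure

/-- The phase space `𝐇¹`: the fields of the Sobolev space above with `div u = 0`. -/
def solenoidal : Submodule ℝ D.Pair where
  carrier := {w | w ∈ D.sobolev ∧ ∀ᵐ x ∂D.measure, ∑ i, w.snd x (i, i) = 0}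
  zero_mem' := by
    refine ⟨D.sobolev.zero_mem, ?_⟩
    filter_upwards [Lp.coeFn_zero (Mat d) 2 D.measure] with x hx
    change ∑ i, ((0 : Lp (Mat d) 2 D.measure) : Vec d → Mat d) x (i, i) = 0
    rw [hx]
    simp
  add_mem' := by
    rintro v w ⟨hv, hv'⟩ ⟨hw, hw'⟩
    refine ⟨D.sobolev.add_mem hv hw, ?_⟩
    filter_upwards [hv', hw', Lp.coeFn_add v.snd w.snd] with x h1 h2 h3
    change ∑ i, ((v.snd + w.snd : Lp (Mat d) 2 D.measure) : Vec d → Mat d) x (i, i) = 0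
    rw [h3]
    simp [Finset.sum_add_distrib, h1, h2]
  smul_mem' := by
    rintro c v ⟨hv, hv'⟩
    refine ⟨D.sobolev.smul_mem c hv, ?_⟩
    filter_upwards [hv', Lp.coeFn_smul c v.snd] with x h1 h2
    change ∑ i, ((c • v.snd : Lp (Mat d) 2 D.measure) : Vec d → Mat d) x (i, i) = 0
    rw [h2]
    simp [← Finset.mul_sum, h1]

/-- The phase space `𝐇¹` as a type, normed by the `H¹` norm. -/
abbrev H1 : Type := D.solenoidal

variable {D}

/-- The field underlying an element of `𝐇¹`. -/
def field (u : D.H1) : D.L2 := u.1.fst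

/-- The weak gradient of an element of `𝐇¹`. -/
def grad (u : D.H1) : Lp (Mat d) 2 D.measure := u.1.snd

/-- `(u,v)_α = (u,v) + α (∇u,∇v)`. -/
def alphaInner (α : ℝ) (u v : D.H1) : ℝ :=
  inner ℝ (field u) (field v) + α * inner ℝ (grad u) (grad v)

/-- `‖u‖_α = (u,u)_α^{1/2}`. -/
def alphaNorm (α : ℝ) (u : D.H1) : ℝ := Real.sqrt (alphaInner α u u)

/-- The Stokes operator `A = -ΠΔ`, as the functional `v ↦ ⟨A u, v⟩ = (∇u,∇v)` on `𝐇¹`. -/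
def stokes (u : D.H1) (v : D.H1) : ℝ := inner ℝ (grad u) (grad v)

/-- The bilinear operator `B(u,w) = Π((u,∇)w)`, as the functional
`v ↦ ((u,∇)w, v) = ∫ ∑_{i,j} u_i ∂_i w_j v_j` on `𝐇¹`. -/
def convection (u w : D.H1) (v : D.H1) : ℝ :=
  ∫ x, ∑ i, ∑ j, field u x i * grad w x (i, j) * field v x j ∂D.measure

/-- A field `g ∈ L²` as the functional `v ↦ (g,v)` on `𝐇¹`. -/
def force (g : D.L2) (v : D.H1) : ℝ := inner ℝ g (field v)

/-- `w = (1 + αA)⁻¹ f`, that is, `w ∈ 𝐇¹` is the weak solution of the Stokes problem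
`w - αΔw + ∇q = f`, `div w = 0`:  `(w,v) + α(∇w,∇v) = ⟨f,v⟩` for all `v ∈ 𝐇¹`. -/
def IsStokesResolvent (α : ℝ) (f : D.H1 → ℝ) (w : D.H1) : Prop :=
  ∀ v : D.H1, alphaInner α w v = f v

/-- `u : I → 𝐇¹` is differentiable in `𝐇¹` and solves on the time interval `I` the equation
`∂_t u + ν A(1+αA)⁻¹ u + (1+αA)⁻¹ B(u,u) = (1+αA)⁻¹ g`
(where `A(1+αA)⁻¹ u = (1+αA)⁻¹ A u`). -/
def IsSolutionOn (α ν : ℝ) (g : D.L2) (I : Set ℝ) (u : ℝ → D.H1) : Prop :=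
  ∀ t ∈ I, ∃ u' a b f : D.H1, HasDerivWithinAt u u' I t ∧
    IsStokesResolvent α (stokes (u t)) a ∧
    IsStokesResolvent α (convection (u t) (u t)) b ∧
    IsStokesResolvent α (force g) f ∧
    u' + ν • a + b = f

/-- The standing assumption on the right-hand side: zero mean in the case of the torus. -/
def IsAdmissibleForce : (D : FlowDomain d) → D.L2 → Prop
  | torus, g => ∫ x, g x ∂(torus : FlowDomain d).measure = 0
  | dirichlet _ _ _ _, _ => True

variable (D)

/-- Eigenvalues of the Stokes operator: `A w = l w` with `w ≠ 0`. -/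
def stokesEigenvalues : Set ℝ :=
  {l | ∃ w : D.H1, w ≠ 0 ∧ ∀ v : D.H1, stokes w v = l * inner ℝ (field w) (field v)}

/-- The first eigenvalue `λ₁` of the Stokes operator. -/
def lambda1 : ℝ := sInf D.stokesEigenvalues

variable {D}

/-- `S` is the semigroup of solution operators `S(t)u₀ = u(t)`: every `S(·)u₀` is a solution on
`[0,∞)` starting at `u₀`, it is the only one on every `[0,T]`, and the semigroup law holds. -/
structure IsSolutionSemigroup (α ν : ℝ) (g : D.L2) (S : ℝ≥0 → D.H1 → D.H1) : Prop where
  zero : S 0 = id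
  add : ∀ s t, S (s + t) = S s ∘ S t
  solves : ∀ u₀ : D.H1, IsSolutionOn α ν g (Ici 0) fun t => S t.toNNReal u₀
  unique : ∀ T : ℝ, 0 < T → ∀ u : ℝ → D.H1, IsSolutionOn α ν g (Icc 0 T) u →
    ∀ t ∈ Icc 0 T, u t = S t.toNNReal (u 0)

/-- A semigroup is dissipative if it has a bounded absorbing set. -/
def IsDissipative (S : ℝ≥0 → D.H1 → D.H1) : Prop :=
  ∃ B : Set D.H1, Bornology.IsBounded B ∧
    ∀ C : Set D.H1, Bornology.IsBounded C → ∃ T : ℝ≥0, ∀ t, T ≤ t → S t '' C ⊆ B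

end FlowDomain

end NSV

end

/-! The resolvent `(1 + αA)⁻¹` gains two derivatives, and this turns the equation into an ordinary
differential equation `u' = F(u)` in the Hilbert space 𝐇¹, where `F` is a polynomial of degree two.
Everything then rests on three facts about `F`.

First, `F` is locally Lipschitz. In dimension two or three `H¹ ⊂ L⁴`, so `u ⊗ v` lies in `L²` and
`⟨B(u,w),v⟩ = (u ⊗ v, ∇w)` is a bounded trilinear form (`exists_tensor`,
`exists_convection_tensor`). Lax-Milgram for `(·,·)_α` supplies the resolvent, and its uniqueness
makes the weak formulation equivalent to the ODE (`isSolutionOn_iff`).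

Second, `⟨B(u,u),u⟩ = 0` for solenoidal `u`. For smooth `φ`, `2((φ,∇)φ,φ) + (|φ|², div φ)` is the
integral of a divergence, hence zero. This identity needs no solenoidal condition, so it passes to
the `H¹` closure of all test fields. Only then is `div u = 0` used, and density of solenoidal test
fields is not needed.

Third, `λ₁‖u‖² ≤ ‖∇u‖²` with `λ₁ > 0`. If `ι` is the embedding of 𝐇¹ into `L²`, then `ι*ι` is
positive, nonzero and compact; its top eigenvalue `k` gives `λ₁ = (1 - k)/k` (`isLeast_lambda1`).
Compactness (Rellich) and positivity of `λ₁` (Poincaré) are derived from one bound, `∫|φ(x+z) -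
φ(x)|² ≤ |z|² ‖∇φ‖²`.

Together they give `(d/dt)‖u‖_α² ≤ -γ‖u‖_α² + ‖g‖²/(νλ₁)` (`voightField_dissipative`). Gronwall
yields the estimate and the absorbing set. The same inequality confines solutions to a ball, so
local solvability becomes global (`exists_semigroup_of_dissipative`). -/

namespace NSV

/-! ### Dissipative ordinary differential equations in a Hilbert space. -/

section AbstractODE

variable {E : Type*} [NormedAddCommGroup E] [InnerProductSpace ℝ E]

/-- The metric projection onto a closed convex set is nonexpansive: add the variational inequalities
of the two projected points and apply Cauchy-Schwarz. It serves to truncate a locally Lipschitz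
vector field to a globally Lipschitz bounded one. -/
theorem exists_lipschitz_retraction_closedBall [CompleteSpace E] {R : ℝ} (hR : 0 ≤ R) :
    ∃ P : E → E, LipschitzWith 1 P ∧ (∀ x, P x ∈ Metric.closedBall (0 : E) R) ∧
      ∀ x ∈ Metric.closedBall (0 : E) R, P x = x := by
  have hne : (Metric.closedBall (0 : E) R).Nonempty := ⟨0, by simpa using hR⟩
  have hconv : Convex ℝ (Metric.closedBall (0 : E) R) := convex_closedBall 0 R
  choose P hPmem hP using exists_norm_eq_iInf_of_complete_convex hne
    Metric.isClosed_closedBall.isComplete hconv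
  have hvar : ∀ x, ∀ w ∈ Metric.closedBall (0 : E) R, inner ℝ (x - P x) (w - P x) ≤ 0 :=
    fun x => (norm_eq_iInf_iff_real_inner_le_zero hconv (hPmem x)).1 (hP x)
  refine ⟨P, ?_, hPmem, ?_⟩
  · refine LipschitzWith.of_dist_le_mul fun x y => ?_
    have h1 := hvar x (P y) (hPmem y)
    have h2 := hvar y (P x) (hPmem x)
    have h3 : ‖P x - P y‖ * ‖P x - P y‖ ≤ inner ℝ (x - y) (P x - P y) := by
      rw [← real_inner_self_eq_norm_mul_norm]
      simp only [inner_sub_left, inner_sub_right] at *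
      linarith
    have h4 := h3.trans (real_inner_le_norm (x - y) (P x - P y))
    rw [dist_eq_norm, dist_eq_norm, NNReal.coe_one, one_mul]
    rcases (norm_nonneg (P x - P y)).eq_or_lt with h0 | h0
    · rw [← h0]; positivity
    · exact le_of_mul_le_mul_right h4 h0
  · intro x hx
    have h := hvar x x hx
    rw [real_inner_self_nonpos, sub_eq_zero] at h
    exact h.symm

/-- A curve of speed at most `L` stays within `L * T` of its start, so one application of
Picard-Lindelöf with that radius covers the whole interval. -/
theorem exists_solution_Icc_of_bounded_lipschitz [CompleteSpace E] {F : E → E} {K L : ℝ≥0}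
    (hF : LipschitzWith K F) (hL : ∀ x, ‖F x‖ ≤ L) {T : ℝ} (hT : 0 ≤ T) (x₀ : E) :
    ∃ u : ℝ → E, u 0 = x₀ ∧ ∀ t ∈ Icc 0 T, HasDerivWithinAt u (F (u t)) (Icc 0 T) t := by
  have hPL : IsPicardLindelof (fun _ => F) (⟨0, left_mem_Icc.2 hT⟩ : Icc (0 : ℝ) T) x₀
      (L * T.toNNReal) 0 L K :=
    { lipschitzOnWith := fun _ _ => hF.lipschitzOnWith
      continuousOn := fun _ _ => continuousOn_const
      norm_le := fun _ _ x _ => hL x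
      mul_max_le := by simp [hT] }
  exact hPL.exists_eq_forall_mem_Icc_hasDerivWithinAt₀

/-- On a compact interval both curves are bounded, so they share a ball on which `F` has a single
Lipschitz constant, and Gronwall's uniqueness argument applies. -/
theorem solution_eqOn_Icc {F : E → E}
    (hF : ∀ R : ℝ, ∃ K : ℝ≥0, LipschitzOnWith K F (Metric.closedBall 0 R)) {T : ℝ}
    {u v : ℝ → E} (hu : ∀ t ∈ Icc 0 T, HasDerivWithinAt u (F (u t)) (Icc 0 T) t)
    (hv : ∀ t ∈ Icc 0 T, HasDerivWithinAt v (F (v t)) (Icc 0 T) t) (h0 : u 0 = v 0) :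
    EqOn u v (Icc 0 T) := by
  have hcu : ContinuousOn u (Icc 0 T) := fun t ht => (hu t ht).continuousWithinAt
  have hcv : ContinuousOn v (Icc 0 T) := fun t ht => (hv t ht).continuousWithinAt
  obtain ⟨R₁, hR₁⟩ := isCompact_Icc.exists_bound_of_continuousOn hcu
  obtain ⟨R₂, hR₂⟩ := isCompact_Icc.exists_bound_of_continuousOn hcv
  obtain ⟨K, hK⟩ := hF (max R₁ R₂)
  have hright : ∀ {w : ℝ → E}, (∀ t ∈ Icc 0 T, HasDerivWithinAt w (F (w t)) (Icc 0 T) t) →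
      ∀ t ∈ Ico 0 T, HasDerivWithinAt w (F (w t)) (Ici t) t := fun hw t ht =>
    (hw t (Ico_subset_Icc_self ht)).mono_of_mem_nhdsWithin
      (Filter.mem_of_superset (Icc_mem_nhdsGE ht.2) (Icc_subset_Icc_left ht.1))
  refine ODE_solution_unique_of_mem_Icc_right (v := fun _ => F)
    (s := fun _ => Metric.closedBall 0 (max R₁ R₂)) (fun _ _ => hK) hcu (hright hu) ?_ hcv
    (hright hv) ?_ h0
  · intro t ht
    simpa using Or.inl (hR₁ t (Ico_subset_Icc_self ht))
  · intro t ht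
    simpa using Or.inr (hR₂ t (Ico_subset_Icc_self ht))

theorem hasDerivWithinAt_quadratic (a : E →L[ℝ] E →L[ℝ] ℝ) (hsymm : ∀ x y, a x y = a y x)
    {u : ℝ → E} {u' : E} {s : Set ℝ} {t : ℝ} (hu : HasDerivWithinAt u u' s t) :
    HasDerivWithinAt (fun r => a (u r) (u r)) (2 * a u' (u t)) s t := by
  have h := (a.hasFDerivAt.comp_hasDerivWithinAt t hu).clm_apply hu
  refine h.congr_deriv ?_
  rw [Function.comp_apply, hsymm (u t) u']
  ring

theorem quadratic_le_of_dissipative (a : E →L[ℝ] E →L[ℝ] ℝ) (hsymm : ∀ x y, a x y = a y x)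
    {F : E → E} {γ M : ℝ} (hγ : 0 < γ) (hdiss : ∀ x, 2 * a (F x) x ≤ -γ * a x x + M)
    {T : ℝ} {u : ℝ → E} (hu : ∀ t ∈ Icc 0 T, HasDerivWithinAt u (F (u t)) (Icc 0 T) t) :
    ∀ t ∈ Icc 0 T, a (u t) (u t) ≤
      a (u 0) (u 0) * Real.exp (-γ * t) + M / γ * (1 - Real.exp (-γ * t)) := by
  have hq : ∀ t ∈ Icc 0 T, HasDerivWithinAt (fun r => a (u r) (u r)) (2 * a (F (u t)) (u t))
      (Icc 0 T) t := fun t ht => hasDerivWithinAt_quadratic a hsymm (hu t ht)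
  intro t ht
  have h := le_gronwallBound_of_liminf_deriv_right_le (a := 0) (b := T)
    (f := fun r => a (u r) (u r)) (f' := fun t => 2 * a (F (u t)) (u t)) (K := -γ) (ε := M)
    (fun t ht => (hq t ht).continuousWithinAt)
    (fun s hs r hr => HasDerivWithinAt.liminf_right_slope_le
      ((hq s (Ico_subset_Icc_self hs)).mono_of_mem_nhdsWithin
        (Filter.mem_of_superset (Icc_mem_nhdsGE hs.2) (Icc_subset_Icc_left hs.1))) hr)
    le_rfl (fun s _ => hdiss (u s)) t ht
  rw [gronwallBound_of_K_ne_0 (neg_ne_zero.2 hγ.ne'), sub_zero] at h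
  refine h.trans (le_of_eq ?_)
  field_simp
  ring

/-- Solve the equation truncated by the projection `P` onto a large ball. The energy `a u u` cannot
cross the level `N`, and the sublevel set lies in the ball by coercivity, so the truncation never
acts along the solution. -/
theorem exists_solution_Icc_of_dissipative [CompleteSpace E] (a : E →L[ℝ] E →L[ℝ] ℝ)
    (hsymm : ∀ x y, a x y = a y x) {c : ℝ} (hc : 0 < c) (hcoer : ∀ x, c * ‖x‖ ^ 2 ≤ a x x)
    {F : E → E} (hF : ∀ R : ℝ, ∃ K : ℝ≥0, LipschitzOnWith K F (Metric.closedBall 0 R))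
    {γ M : ℝ} (hγ : 0 < γ) (hdiss : ∀ x, 2 * a (F x) x ≤ -γ * a x x + M)
    {T : ℝ} (hT : 0 ≤ T) (x₀ : E) :
    ∃ u : ℝ → E, u 0 = x₀ ∧ ∀ t ∈ Icc 0 T, HasDerivWithinAt u (F (u t)) (Icc 0 T) t := by
  -- The summand `1` makes the energy strictly decreasing at the level `N`: there `-γ * N + M ≤ -γ <
  -- 0`, as the barrier argument requires.
  set N : ℝ := max (a x₀ x₀) (M / γ + 1) with hN
  have hN0 : 0 ≤ N := le_max_of_le_left ((by positivity : (0:ℝ) ≤ c * ‖x₀‖ ^ 2).trans (hcoer x₀))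
  set R : ℝ := Real.sqrt (N / c) with hRdef
  have hball : ∀ x, a x x ≤ N → x ∈ Metric.closedBall (0 : E) R := by
    intro x hx
    rw [mem_closedBall_zero_iff, hRdef]
    apply Real.le_sqrt_of_sq_le
    rw [le_div_iff₀ hc]
    linarith [hcoer x]
  obtain ⟨P, hP1, hPmem, hPid⟩ := exists_lipschitz_retraction_closedBall (E := E)
    (Real.sqrt_nonneg (N / c))
  obtain ⟨K, hK⟩ := hF R
  have hG : LipschitzWith K (F ∘ P) := by
    have := hK.comp (hP1.lipschitzOnWith (s := univ)) fun x _ => hPmem x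
    rwa [mul_one, lipschitzOnWith_univ] at this
  have hGb : ∀ x, ‖(F ∘ P) x‖ ≤ (‖F 0‖₊ + K * R.toNNReal : ℝ≥0) := by
    intro x
    have h0 : (0 : E) ∈ Metric.closedBall (0 : E) R := by simp [hRdef, Real.sqrt_nonneg]
    have h1 := hK.dist_le_mul _ (hPmem x) _ h0
    have h2 := mem_closedBall_zero_iff.1 (hPmem x)
    rw [dist_eq_norm, dist_zero_right] at h1
    have h3 := norm_le_norm_add_norm_sub' (F (P x)) (F 0)
    push_cast
    rw [Real.coe_toNNReal R (Real.sqrt_nonneg _)]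
    have h4 : (K : ℝ) * ‖P x‖ ≤ K * R := by gcongr
    simp only [Function.comp_apply]
    linarith
  obtain ⟨u, hu0, hu⟩ := exists_solution_Icc_of_bounded_lipschitz hG hGb hT x₀
  have hq : ∀ t ∈ Icc 0 T, HasDerivWithinAt (fun r => a (u r) (u r))
      (2 * a ((F ∘ P) (u t)) (u t)) (Icc 0 T) t :=
    fun t ht => hasDerivWithinAt_quadratic a hsymm (hu t ht)
  have hle := image_le_of_deriv_right_lt_deriv_boundary (a := 0) (b := T)
    (f := fun r => a (u r) (u r)) (B := fun _ => N) (B' := fun _ => 0)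
    (fun t ht => (hq t ht).continuousWithinAt)
    (fun s hs => (hq s (Ico_subset_Icc_self hs)).mono_of_mem_nhdsWithin
        (Filter.mem_of_superset (Icc_mem_nhdsGE hs.2) (Icc_subset_Icc_left hs.1)))
    (by simp [hu0, hN]) (fun x => hasDerivAt_const x N) (by
      intro t _ hEq
      have hmem := hball (u t) hEq.le
      simp only [Function.comp_apply, hPid _ hmem]
      have h1 := hdiss (u t)
      have h2 : M / γ + 1 ≤ a (u t) (u t) := by rw [hEq]; exact le_max_right _ _
      have h3 : M + γ ≤ γ * a (u t) (u t) := by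
        have := mul_le_mul_of_nonneg_left h2 hγ.le
        rwa [mul_add, mul_div_cancel₀ _ hγ.ne', mul_one] at this
      linarith)
  refine ⟨u, hu0, fun t ht => ?_⟩
  have := hu t ht
  rwa [Function.comp_apply, hPid _ (hball _ (hle ht))] at this

/-- Solutions `U x T` on different intervals agree where both are defined, so evaluating each at its
right endpoint gives one global flow. The semigroup law is uniqueness applied to a time shift. -/
theorem exists_semigroup_of_dissipative [CompleteSpace E] (a : E →L[ℝ] E →L[ℝ] ℝ)
    (hsymm : ∀ x y, a x y = a y x) {c : ℝ} (hc : 0 < c) (hcoer : ∀ x, c * ‖x‖ ^ 2 ≤ a x x)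
    {F : E → E} (hF : ∀ R : ℝ, ∃ K : ℝ≥0, LipschitzOnWith K F (Metric.closedBall 0 R))
    {γ M : ℝ} (hγ : 0 < γ) (hdiss : ∀ x, 2 * a (F x) x ≤ -γ * a x x + M) :
    ∃ S : ℝ≥0 → E → E, S 0 = id ∧ (∀ s t, S (s + t) = S s ∘ S t) ∧
      (∀ x, ∀ t ∈ Ici (0 : ℝ), HasDerivWithinAt (fun r : ℝ => S r.toNNReal x)
        (F (S t.toNNReal x)) (Ici 0) t) ∧
      ∀ T : ℝ, ∀ u : ℝ → E, (∀ t ∈ Icc 0 T, HasDerivWithinAt u (F (u t)) (Icc 0 T) t) →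
        ∀ t ∈ Icc 0 T, u t = S t.toNNReal (u 0) := by
  have hex : ∀ (x : E) (T : ℝ≥0), ∃ u : ℝ → E, u 0 = x ∧
      ∀ t ∈ Icc (0 : ℝ) T, HasDerivWithinAt u (F (u t)) (Icc (0 : ℝ) T) t := fun x T =>
    exists_solution_Icc_of_dissipative a hsymm hc hcoer hF hγ hdiss T.2 x
  choose U hU0 hU using hex
  have huniq : ∀ T : ℝ, ∀ u : ℝ → E,
      (∀ t ∈ Icc 0 T, HasDerivWithinAt u (F (u t)) (Icc 0 T) t) →
        ∀ t ∈ Icc 0 T, u t = U (u 0) t.toNNReal t := by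
    intro T u hu t ht
    refine solution_eqOn_Icc hF (T := t) (fun s hs => ?_) (fun s hs => ?_) (hU0 _ _).symm
      (right_mem_Icc.2 ht.1)
    · exact (hu s ⟨hs.1, hs.2.trans ht.2⟩).mono (Icc_subset_Icc_right ht.2)
    · have := hU (u 0) t.toNNReal s
      rw [Real.coe_toNNReal t ht.1] at this
      exact this hs
  have hsol : ∀ x, ∀ t ∈ Ici (0 : ℝ), HasDerivWithinAt (fun r : ℝ => U x r.toNNReal r)
        (F (U x t.toNNReal t)) (Ici 0) t := by
    intro x t ht
    have ht : 0 ≤ t := ht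
    -- An endpoint strictly beyond `t` makes `Icc 0 T` a neighbourhood of `t` within `Ici 0`, so the
    -- derivative transfers to the half-line.
    set T : ℝ≥0 := t.toNNReal + 1 with hTdef
    have hT : (T : ℝ) = t + 1 := by simp [hTdef, ht]
    have heq : ∀ s ∈ Icc (0 : ℝ) T, U x T s = U x s.toNNReal s := by
      intro s hs
      have := huniq T (U x T) (hU x T) s hs
      rwa [hU0] at this
    have htT : t ∈ Icc (0 : ℝ) T := ⟨ht, by rw [hT]; linarith⟩
    have h1 := (hU x T t htT).congr_of_mem (fun s hs => (heq s hs).symm) htT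
    rw [heq t htT] at h1
    refine h1.mono_of_mem_nhdsWithin ?_
    rw [mem_nhdsWithin]
    exact ⟨Iio (T : ℝ), isOpen_Iio, by rw [mem_Iio, hT]; linarith,
      fun s hs => ⟨hs.2, le_of_lt hs.1⟩⟩
  refine ⟨fun t x => U x t t, ?_, ?_, ?_, ?_⟩
  · funext x
    exact hU0 x 0
  · intro s t
    funext x
    have hu : ∀ r ∈ Icc (0 : ℝ) s, HasDerivWithinAt (fun r : ℝ => U x (r + t).toNNReal (r + t))
        (F (U x (r + t).toNNReal (r + t))) (Icc (0 : ℝ) s) r := by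
      intro r hr
      have h1 := hsol x (r + t) (add_nonneg hr.1 t.2)
      have h2 : HasDerivWithinAt (fun r : ℝ => r + (t : ℝ)) 1 (Icc (0 : ℝ) s) r :=
        (hasDerivWithinAt_id r _).add_const _
      have h3 := h1.scomp r h2 (fun q hq => add_nonneg hq.1 t.2)
      simpa [Function.comp_def] using h3
    have h := huniq s _ hu s (right_mem_Icc.2 s.2)
    simp only [zero_add, Real.toNNReal_coe] at h
    rw [← NNReal.coe_add, Real.toNNReal_coe] at h
    exact h
  · intro x t ht
    refine (hsol x t ht).congr_of_mem (fun r hr => ?_) ht |>.congr_deriv ?_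
    · simp only [Real.coe_toNNReal r hr]
    · simp only [Real.coe_toNNReal t ht]
  · intro T u hu t ht
    simp only [Real.coe_toNNReal t ht.1]
    exact huniq T u hu t ht

end AbstractODE

/-! ### Period lattice and translation invariance of integrals. -/

open scoped Pointwise

namespace FlowDomain

variable {d : ℕ}

/-- The basis `2π e_i` of the lattice of periods of the torus. -/
noncomputable def periodBasis (d : ℕ) : Module.Basis (Fin d) ℝ (Vec d) :=
  (EuclideanSpace.basisFun (Fin d) ℝ).toBasis.unitsSMul
    fun _ => Units.mk0 (2 * Real.pi) Real.two_pi_pos.ne'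

theorem periodBasis_apply (i : Fin d) :
    periodBasis d i = EuclideanSpace.single i (2 * Real.pi) := by
  simp only [periodBasis, Module.Basis.unitsSMul_apply, OrthonormalBasis.coe_toBasis,
    EuclideanSpace.basisFun_apply, Units.smul_def, Units.val_mk0]
  ext j
  simp

theorem fundamentalDomain_periodBasis :
    ZSpan.fundamentalDomain (periodBasis d) = (torus : FlowDomain d).region := by
  ext x
  have : ∀ i, (periodBasis d).repr x i = (2 * Real.pi)⁻¹ * x i := by
    intro i
    simp only [periodBasis, Module.Basis.repr_unitsSMul, Units.smul_def, smul_eq_mul]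
    simp [EuclideanSpace.basisFun_repr]
  simp only [ZSpan.mem_fundamentalDomain, this, region, mem_ofPred_eq, mem_Ico]
  refine forall_congr' fun i => ?_
  have hp := Real.two_pi_pos
  rw [inv_mul_lt_iff₀ hp, mul_one]
  refine and_congr_left' ?_
  rw [mul_nonneg_iff_of_pos_left (inv_pos.2 hp)]

theorem measurableSet_region (D : FlowDomain d) : MeasurableSet D.region := by
  cases D with
  | torus =>
    rw [← fundamentalDomain_periodBasis]
    exact ZSpan.fundamentalDomain_measurableSet _
  | dirichlet Ω h _ _ => exact h.measurableSet

theorem isBounded_region (D : FlowDomain d) : Bornology.IsBounded D.region := by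
  cases D with
  | torus =>
    rw [← fundamentalDomain_periodBasis]
    exact ZSpan.fundamentalDomain_isBounded _
  | dirichlet Ω _ h _ => exact h

instance isFiniteMeasure_measure (D : FlowDomain d) : IsFiniteMeasure D.measure :=
  ⟨by rw [measure, Measure.restrict_apply_univ]; exact D.isBounded_region.measure_lt_top⟩

/-- Functions that are periodic if the flow domain is the torus, and arbitrary otherwise. -/
def IsPeriodic {β : Type*} : FlowDomain d → (Vec d → β) → Prop
  | torus, f => ∀ x i, f (x + EuclideanSpace.single i (2 * Real.pi)) = f x
  | dirichlet _ _ _ _, _ => True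

theorem IsPeriodic.comp {β γ : Type*} {D : FlowDomain d} {f : Vec d → β} (hf : D.IsPeriodic f)
    (g : β → γ) : D.IsPeriodic fun x => g (f x) := by
  cases D with
  | torus => exact fun x i => congrArg g (hf x i)
  | dirichlet _ _ _ _ => trivial

theorem IsPeriodic.comp₂ {β β' γ : Type*} {D : FlowDomain d} {f : Vec d → β} {f' : Vec d → β'}
    (hf : D.IsPeriodic f) (hf' : D.IsPeriodic f') (g : β → β' → γ) :
    D.IsPeriodic fun x => g (f x) (f' x) := by
  cases D with
  | torus => exact fun x i => by simp only [hf x i, hf' x i]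
  | dirichlet _ _ _ _ => trivial

theorem periodic_vadd_lattice {β : Type*} {f : Vec d → β}
    (hf : ∀ x i, f (x + EuclideanSpace.single i (2 * Real.pi)) = f x)
    (v : (Submodule.span ℤ (range (periodBasis d))).toAddSubgroup) (x : Vec d) :
    f (v +ᵥ x) = f x := by
  obtain ⟨v, hv⟩ := v
  change f (v + x) = f x
  rw [Submodule.mem_toAddSubgroup] at hv
  induction hv using Submodule.span_induction generalizing x with
  | mem v hv =>
    obtain ⟨i, rfl⟩ := hv
    rw [periodBasis_apply, add_comm, hf]
  | zero => rw [zero_add]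
  | add v w _ _ hv hw => rw [add_assoc, hv, hw]
  | smul n v _ hv =>
    have hneg : ∀ y, f (-v + y) = f y := fun y => by rw [← hv (-v + y), add_neg_cancel_left]
    induction n using Int.induction_on generalizing x with
    | zero => rw [zero_smul, zero_add]
    | succ n ih => rw [add_smul, one_smul, add_assoc, ih, hv]
    | pred n ih => rw [sub_smul, one_smul, sub_eq_add_neg, add_assoc, ih, hneg]

instance countable_periodLattice :
    Countable (Submodule.span ℤ (range (periodBasis d))).toAddSubgroup :=
  inferInstanceAs (Countable (Submodule.span ℤ (range (periodBasis d))))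

theorem isAddFundamentalDomain_torus :
    IsAddFundamentalDomain (Submodule.span ℤ (range (periodBasis d))).toAddSubgroup
      (torus : FlowDomain d).region volume := by
  rw [← fundamentalDomain_periodBasis]
  exact ZSpan.isAddFundamentalDomain' _ _

/-- A measure extending the measure of the flow domain, under which integrals of periodic functions
are translation invariant: Lebesgue measure on the whole space in the Dirichlet case. -/
noncomputable def ambient : FlowDomain d → Measure (Vec d)
  | torus => (torus : FlowDomain d).measure
  | dirichlet _ _ _ _ => volume

instance sFinite_ambient (D : FlowDomain d) : SFinite D.ambient := by
  cases D with
  | torus => exact inferInstanceAs (SFinite (torus : FlowDomain d).measure)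
  | dirichlet _ _ _ _ => exact inferInstanceAs (SFinite (volume : Measure (Vec d)))

/-- On the torus a translated period cell is again a fundamental domain of the period lattice, and a
periodic function has the same integral over any two of them. -/
theorem lintegral_ambient_add {D : FlowDomain d} {F : Vec d → ℝ≥0∞} (hF : D.IsPeriodic F)
    (z : Vec d) : ∫⁻ x, F (x + z) ∂D.ambient = ∫⁻ x, F x ∂D.ambient := by
  cases D with
  | dirichlet _ _ _ _ => exact lintegral_add_right_eq_self (μ := volume) F z
  | torus =>
    have h1 := (isAddFundamentalDomain_torus (d := d)).vadd_of_comm z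
    have h2 := h1.setLIntegral_eq isAddFundamentalDomain_torus F (periodic_vadd_lattice hF)
    have h3 := (measurePreserving_add_right (volume : Measure (Vec d)) z).setLIntegral_comp_emb
      (measurableEmbedding_addRight z) F (torus : FlowDomain d).region
    have h4 : (fun x => x + z) '' (torus : FlowDomain d).region
        = z +ᵥ (torus : FlowDomain d).region := by
      simp only [← Set.image_vadd, vadd_eq_add, add_comm]
    rw [h4] at h3
    exact h3.trans h2

theorem integral_ambient_add {β : Type*} [NormedAddCommGroup β] [NormedSpace ℝ β]
    {D : FlowDomain d} {F : Vec d → β} (hF : D.IsPeriodic F)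
    (z : Vec d) : ∫ x, F (x + z) ∂D.ambient = ∫ x, F x ∂D.ambient := by
  cases D with
  | dirichlet _ _ _ _ => exact integral_add_right_eq_self (μ := volume) F z
  | torus =>
    have h1 := (isAddFundamentalDomain_torus (d := d)).vadd_of_comm z
    have h2 := h1.setIntegral_eq isAddFundamentalDomain_torus (periodic_vadd_lattice hF)
    have h3 := (measurePreserving_add_right (volume : Measure (Vec d)) z).setIntegral_image_emb
      (measurableEmbedding_addRight z) F (torus : FlowDomain d).region
    have h4 : (fun x => x + z) '' (torus : FlowDomain d).region
        = z +ᵥ (torus : FlowDomain d).region := by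
      simp only [← Set.image_vadd, vadd_eq_add, add_comm]
    rw [h4] at h3
    exact h3.symm.trans h2

end FlowDomain

/-! ### Pointwise properties of the gradient matrix. -/

theorem classicalGrad_apply (φ : Vec d → Vec d) (x : Vec d) (i j : Fin d) :
    classicalGrad φ x (i, j) = fderiv ℝ φ x (EuclideanSpace.single i 1) j := rfl

theorem fderiv_apply_eq_sum_classicalGrad (φ : Vec d → Vec d) (x z : Vec d) (j : Fin d) :
    fderiv ℝ φ x z j = ∑ i, z i * classicalGrad φ x (i, j) := by
  have hz : z = ∑ i, z i • EuclideanSpace.single i (1 : ℝ) := by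
    ext k
    simp [Finset.sum_apply, Pi.single_apply]
  conv_lhs => rw [hz]
  simp [classicalGrad_apply]

theorem norm_fderiv_apply_le (φ : Vec d → Vec d) (x z : Vec d) :
    ‖fderiv ℝ φ x z‖ ≤ ‖z‖ * ‖classicalGrad φ x‖ := by
  refine le_of_sq_le_sq ?_ (by positivity)
  rw [mul_pow, EuclideanSpace.real_norm_sq_eq, EuclideanSpace.real_norm_sq_eq,
    EuclideanSpace.real_norm_sq_eq, Fintype.sum_prod_type_right, Finset.mul_sum]
  refine Finset.sum_le_sum fun j _ => ?_
  rw [fderiv_apply_eq_sum_classicalGrad]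
  exact Finset.sum_mul_sq_le_sq_mul_sq _ _ _

theorem norm_fderiv_le_norm_classicalGrad (φ : Vec d → Vec d) (x : Vec d) :
    ‖fderiv ℝ φ x‖ ≤ ‖classicalGrad φ x‖ :=
  ContinuousLinearMap.opNorm_le_bound _ (norm_nonneg _) fun z => by
    rw [mul_comm]; exact norm_fderiv_apply_le φ x z

theorem classicalGrad_add {φ ψ : Vec d → Vec d} (hφ : Differentiable ℝ φ)
    (hψ : Differentiable ℝ ψ) :
    classicalGrad (φ + ψ) = classicalGrad φ + classicalGrad ψ := by
  funext x
  ext ⟨i, j⟩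
  simp [classicalGrad_apply, fderiv_add (hφ x) (hψ x)]

theorem classicalGrad_const_smul {φ : Vec d → Vec d} (hφ : Differentiable ℝ φ) (c : ℝ) :
    classicalGrad (c • φ) = c • classicalGrad φ := by
  funext x
  ext ⟨i, j⟩
  simp [classicalGrad_apply, fderiv_const_smul (hφ x)]

theorem continuous_classicalGrad {φ : Vec d → Vec d} (hφ : ContDiff ℝ ∞ φ) :
    Continuous (classicalGrad φ) := by
  refine (PiLp.continuous_toLp 2 _).comp (continuous_pi fun ij => ?_)
  have h : Continuous fun x => fderiv ℝ φ x (EuclideanSpace.single ij.1 1) :=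
    (hφ.continuous_fderiv (by simp)).clm_apply continuous_const
  exact (EuclideanSpace.proj (𝕜 := ℝ) ij.2).continuous.comp h

/-! ### Test fields and their closure, the Sobolev space. -/

namespace FlowDomain

variable {D : FlowDomain d}

theorem memLp_of_continuous {β : Type*} [NormedAddCommGroup β] [SecondCountableTopology β]
    {f : Vec d → β} (hf : Continuous f) (p : ℝ≥0∞) :
    MemLp f p D.measure := by
  obtain ⟨C, hC⟩ := D.isBounded_region.isCompact_closure.exists_bound_of_continuousOn
    hf.continuousOn
  refine MemLp.of_bound hf.aestronglyMeasurable C ?_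
  filter_upwards [ae_restrict_mem D.measurableSet_region] with x hx
  exact hC x (subset_closure hx)

/-- Functions vanishing outside `Ω` in the Dirichlet case, and arbitrary ones on the torus. -/
def VanishesOutside {β : Type*} [Zero β] : FlowDomain d → (Vec d → β) → Prop
  | torus, _ => True
  | dirichlet Ω _ _ _, f => ∀ x, x ∉ Ω → f x = 0

theorem VanishesOutside.comp {β γ : Type*} [Zero β] [Zero γ] {f : Vec d → β}
    (hf : D.VanishesOutside f) (g : Vec d → β → γ) (hg : ∀ x, g x 0 = 0) :
    D.VanishesOutside fun x => g x (f x) := by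
  cases D with
  | torus => trivial
  | dirichlet Ω _ _ _ => exact fun x hx => by simp [hf x hx, hg]

theorem lintegral_ambient_eq {F : Vec d → ℝ≥0∞} (hF : D.VanishesOutside F) :
    ∫⁻ x, F x ∂D.ambient = ∫⁻ x, F x ∂D.measure := by
  cases D with
  | torus => rfl
  | dirichlet Ω hΩ _ _ =>
    refine (setLIntegral_eq_of_support_subset fun x hx => ?_).symm
    by_contra h
    exact hx (hF x h)

theorem integral_ambient_eq {β : Type*} [NormedAddCommGroup β] [NormedSpace ℝ β]
    {F : Vec d → β} (hF : D.VanishesOutside F) :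
    ∫ x, F x ∂D.ambient = ∫ x, F x ∂D.measure := by
  cases D with
  | torus => rfl
  | dirichlet Ω hΩ _ _ => exact (setIntegral_eq_integral_of_forall_compl_eq_zero hF).symm

theorem measure_le_ambient (D : FlowDomain d) : D.measure ≤ D.ambient := by
  cases D with
  | torus => exact le_rfl
  | dirichlet Ω hΩ _ _ => exact Measure.restrict_le_self

namespace IsTestField

variable {φ ψ : Vec d → Vec d}

theorem contDiff (hφ : D.IsTestField φ) : ContDiff ℝ ∞ φ := by
  cases D with
  | torus => exact hφ.1
  | dirichlet Ω _ _ _ => exact hφ.1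

theorem differentiable (hφ : D.IsTestField φ) : Differentiable ℝ φ :=
  hφ.contDiff.differentiable (by simp)

theorem continuous (hφ : D.IsTestField φ) : Continuous φ := hφ.contDiff.continuous

theorem continuous_classicalGrad (hφ : D.IsTestField φ) : Continuous (classicalGrad φ) :=
  NSV.continuous_classicalGrad hφ.contDiff

theorem isPeriodic (hφ : D.IsTestField φ) : D.IsPeriodic φ := by
  cases D with
  | torus => exact hφ.2.1
  | dirichlet Ω _ _ _ => trivial

theorem isPeriodic_fderiv (hφ : D.IsTestField φ) : D.IsPeriodic (fderiv ℝ φ) := by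
  cases D with
  | torus =>
    intro x i
    rw [← fderiv_comp_add_right]
    congr 1
    funext y
    exact hφ.2.1 y i
  | dirichlet Ω _ _ _ => trivial

theorem isPeriodic_classicalGrad (hφ : D.IsTestField φ) : D.IsPeriodic (classicalGrad φ) :=
  hφ.isPeriodic_fderiv.comp fun L : Vec d →L[ℝ] Vec d => (WithLp.toLp 2
    fun ij : Fin d × Fin d => L (EuclideanSpace.single ij.1 1) ij.2 : Mat d)

theorem vanishesOutside (hφ : D.IsTestField φ) : D.VanishesOutside φ := by
  cases D with
  | torus => trivial
  | dirichlet Ω _ _ _ => exact fun x hx => image_eq_zero_of_notMem_tsupport fun h => hx (hφ.2.2 h)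

theorem vanishesOutside_fderiv (hφ : D.IsTestField φ) : D.VanishesOutside (fderiv ℝ φ) := by
  cases D with
  | torus => trivial
  | dirichlet Ω _ _ _ =>
    exact fun x hx => image_eq_zero_of_notMem_tsupport fun h =>
      hx (hφ.2.2 (tsupport_fderiv_subset ℝ h))

theorem vanishesOutside_classicalGrad (hφ : D.IsTestField φ) :
    D.VanishesOutside (classicalGrad φ) :=
  hφ.vanishesOutside_fderiv.comp (fun _ (L : Vec d →L[ℝ] Vec d) => (WithLp.toLp 2
    fun ij : Fin d × Fin d => L (EuclideanSpace.single ij.1 1) ij.2 : Mat d))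
    fun x => by ext; simp

theorem memLp (hφ : D.IsTestField φ) (p : ℝ≥0∞) : MemLp φ p D.measure :=
  memLp_of_continuous hφ.continuous p

theorem memLp_classicalGrad (hφ : D.IsTestField φ) (p : ℝ≥0∞) :
    MemLp (classicalGrad φ) p D.measure :=
  memLp_of_continuous hφ.continuous_classicalGrad p

theorem zero : D.IsTestField (0 : Vec d → Vec d) := by
  cases D with
  | torus => exact ⟨contDiff_const, fun _ _ => rfl, by simp⟩
  | dirichlet Ω _ _ _ => exact ⟨contDiff_const, HasCompactSupport.zero, by simp [tsupport]⟩

theorem add (hφ : D.IsTestField φ) (hψ : D.IsTestField ψ) : D.IsTestField (φ + ψ) := by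
  have h1 := (hφ.memLp 1).integrable le_rfl
  have h2 := (hψ.memLp 1).integrable le_rfl
  cases D with
  | torus =>
    refine ⟨hφ.1.add hψ.1, fun x i => by simp [hφ.2.1 x i, hψ.2.1 x i], ?_⟩
    simp only [Pi.add_apply]
    rw [integral_add h1 h2, hφ.2.2, hψ.2.2, add_zero]
  | dirichlet Ω _ _ _ =>
    exact ⟨hφ.1.add hψ.1, hφ.2.1.add hψ.2.1,
      (tsupport_add φ ψ).trans (union_subset hφ.2.2 hψ.2.2)⟩

theorem const_smul (hφ : D.IsTestField φ) (c : ℝ) : D.IsTestField (c • φ) := by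
  cases D with
  | torus =>
    refine ⟨contDiff_const.smul hφ.1, fun x i => by simp [hφ.2.1 x i], ?_⟩
    simp only [Pi.smul_apply]
    rw [integral_smul, hφ.2.2, smul_zero]
  | dirichlet Ω _ _ _ =>
    exact ⟨contDiff_const.smul hφ.1, hφ.2.1.smul_left (f := fun _ => c),
      (tsupport_smul_subset_right (fun _ => c) φ).trans hφ.2.2⟩

/-- A test field with its gradient, as an element of `H¹`. -/
noncomputable def pair (hφ : D.IsTestField φ) : D.Pair :=
  WithLp.toLp 2 ((hφ.memLp 2).toLp φ, (hφ.memLp_classicalGrad 2).toLp (classicalGrad φ))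

theorem pair_fst_ae (hφ : D.IsTestField φ) : hφ.pair.fst =ᵐ[D.measure] φ :=
  MemLp.coeFn_toLp (hφ.memLp 2)

theorem pair_snd_ae (hφ : D.IsTestField φ) : hφ.pair.snd =ᵐ[D.measure] classicalGrad φ :=
  MemLp.coeFn_toLp (hφ.memLp_classicalGrad 2)

end IsTestField

/-- The test fields with their gradients, as a subspace of `H¹`. -/
noncomputable def testPairs (D : FlowDomain d) : Submodule ℝ D.Pair where
  carrier := {w : D.Pair | ∃ φ : Vec d → Vec d, ∃ hφ : D.IsTestField φ, w = hφ.pair}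
  zero_mem' := by
    refine ⟨0, .zero, ?_⟩
    refine WithLp.ofLp_injective 2 (Prod.ext (Lp.ext ?_) (Lp.ext ?_))
    · exact (Lp.coeFn_zero _ _ _).trans (IsTestField.zero (D := D)).pair_fst_ae.symm
    · refine (Lp.coeFn_zero _ _ _).trans (.trans (.of_eq ?_)
        (IsTestField.zero (D := D)).pair_snd_ae.symm)
      funext x
      ext ⟨i, j⟩
      simp [classicalGrad_apply]
  add_mem' := by
    rintro _ _ ⟨φ, hφ, rfl⟩ ⟨ψ, hψ, rfl⟩
    refine ⟨φ + ψ, hφ.add hψ, ?_⟩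
    refine WithLp.ofLp_injective 2 (Prod.ext ?_ ?_)
    · exact (MemLp.toLp_add (hφ.memLp 2) (hψ.memLp 2)).symm
    · refine (MemLp.toLp_add (hφ.memLp_classicalGrad 2) (hψ.memLp_classicalGrad 2)).symm.trans ?_
      exact MemLp.toLp_congr _ ((hφ.add hψ).memLp_classicalGrad 2)
        (.of_eq (classicalGrad_add hφ.differentiable hψ.differentiable).symm)
  smul_mem' := by
    rintro c _ ⟨φ, hφ, rfl⟩
    refine ⟨c • φ, hφ.const_smul c, ?_⟩
    refine WithLp.ofLp_injective 2 (Prod.ext ?_ ?_)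
    · exact (MemLp.toLp_const_smul c (hφ.memLp 2)).symm
    · refine (MemLp.toLp_const_smul c (hφ.memLp_classicalGrad 2)).symm.trans ?_
      exact MemLp.toLp_congr _ ((hφ.const_smul c).memLp_classicalGrad 2)
        (.of_eq (classicalGrad_const_smul hφ.differentiable c).symm)

theorem mem_testPairs {w : D.Pair} :
    w ∈ D.testPairs ↔ ∃ φ : Vec d → Vec d, ∃ hφ : D.IsTestField φ, w = hφ.pair := Iff.rfl

/-- Test pairs are already a linear subspace, so taking the span in the definition adds nothing. -/
theorem sobolev_eq_closure (D : FlowDomain d) : D.sobolev = D.testPairs.topologicalClosure := by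
  rw [sobolev]
  congr 1
  have : {w : D.Pair | ∃ φ : Vec d → Vec d, D.IsTestField φ ∧
      (w.fst : Vec d → Vec d) =ᵐ[D.measure] φ ∧
      (w.snd : Vec d → Mat d) =ᵐ[D.measure] classicalGrad φ} = D.testPairs := by
    ext w
    rw [SetLike.mem_coe, mem_testPairs]
    constructor
    · rintro ⟨φ, hφ, h1, h2⟩
      exact ⟨φ, hφ, WithLp.ofLp_injective 2 (Prod.ext (Lp.ext (h1.trans hφ.pair_fst_ae.symm))
        (Lp.ext (h2.trans hφ.pair_snd_ae.symm)))⟩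
    · rintro ⟨φ, hφ, rfl⟩
      exact ⟨φ, hφ, hφ.pair_fst_ae, hφ.pair_snd_ae⟩
  rw [this, Submodule.span_eq]

theorem IsTestField.pair_mem_sobolev {φ : Vec d → Vec d} (hφ : D.IsTestField φ) :
    hφ.pair ∈ D.sobolev := by
  rw [sobolev_eq_closure]
  exact D.testPairs.le_topologicalClosure (mem_testPairs.2 ⟨φ, hφ, rfl⟩)

/-- The density principle by which inequalities proved for smooth fields pass to the whole Sobolev
space. -/
theorem sobolev_induction {p : D.Pair → Prop} (hp : IsClosed {w | p w})
    (htest : ∀ φ : Vec d → Vec d, ∀ hφ : D.IsTestField φ, p hφ.pair) {w : D.Pair}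
    (hw : w ∈ D.sobolev) : p w := by
  rw [sobolev_eq_closure] at hw
  refine closure_minimal (t := {w | p w}) ?_ hp hw
  intro v hv
  obtain ⟨φ, hφ, rfl⟩ := mem_testPairs.1 hv
  exact htest φ hφ

end FlowDomain

/-! ### The translation estimate and the vanishing integral of a derivative. -/

theorem sq_lintegral_le_lintegral_sq {X : Type*} [MeasurableSpace X] {μ : Measure X}
    [IsProbabilityMeasure μ] {f : X → ℝ≥0∞} (hf : AEMeasurable f μ) :
    (∫⁻ x, f x ∂μ) ^ 2 ≤ ∫⁻ x, f x ^ 2 ∂μ := by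
  have h := ENNReal.lintegral_mul_le_Lp_mul_Lq μ Real.HolderConjugate.two_two hf
    (aemeasurable_const (b := (1 : ℝ≥0∞)))
  simp only [Pi.mul_apply, mul_one, ENNReal.one_rpow, lintegral_const, measure_univ] at h
  have h2 := pow_le_pow_left₀ zero_le h 2
  rwa [← ENNReal.rpow_natCast (_ ^ (1 / 2 : ℝ)), ← ENNReal.rpow_mul,
    show (1 / 2 : ℝ) * (2 : ℕ) = 1 by norm_num, ENNReal.rpow_one,
    lintegral_congr fun x => ENNReal.rpow_two (f x)] at h2

/-- The fundamental theorem of calculus along the segment from `x` to `x + z`, followed by Jensen's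
inequality on the unit interval. -/
theorem enorm_sq_add_sub_le {φ : Vec d → Vec d} (hφ : ContDiff ℝ ∞ φ) (x z : Vec d) :
    ‖φ (x + z) - φ x‖ₑ ^ 2 ≤
      ∫⁻ t in Ioc (0 : ℝ) 1, ‖z‖ₑ ^ 2 * ‖classicalGrad φ (x + t • z)‖ₑ ^ 2 := by
  have hcont : Continuous fun t : ℝ => fderiv ℝ φ (x + t • z) z :=
    ((hφ.continuous_fderiv (by simp)).comp (by fun_prop)).clm_apply continuous_const
  have hderiv : ∀ t ∈ uIcc (0 : ℝ) 1,
      HasDerivAt (fun t : ℝ => φ (x + t • z)) (fderiv ℝ φ (x + t • z) z) t := by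
    intro t _
    have h1 : HasDerivAt (fun t : ℝ => x + t • z) z t := by
      simpa using ((hasDerivAt_id t).smul_const z).const_add x
    exact ((hφ.differentiable (by simp)) (x + t • z)).hasFDerivAt.comp_hasDerivAt t h1
  have h := intervalIntegral.integral_eq_sub_of_hasDerivAt hderiv
    (hcont.intervalIntegrable 0 1)
  rw [intervalIntegral.integral_of_le zero_le_one] at h
  simp only [one_smul, zero_smul, add_zero] at h
  have : IsProbabilityMeasure (volume.restrict (Ioc (0 : ℝ) 1)) := ⟨by simp⟩
  rw [← h]
  calc ‖∫ t in Ioc (0 : ℝ) 1, fderiv ℝ φ (x + t • z) z‖ₑ ^ 2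
      ≤ (∫⁻ t in Ioc (0 : ℝ) 1, ‖fderiv ℝ φ (x + t • z) z‖ₑ) ^ 2 := by
        gcongr
        exact enorm_integral_le_lintegral_enorm _
    _ ≤ ∫⁻ t in Ioc (0 : ℝ) 1, ‖fderiv ℝ φ (x + t • z) z‖ₑ ^ 2 :=
        sq_lintegral_le_lintegral_sq hcont.enorm.measurable.aemeasurable
    _ ≤ _ := by
        refine lintegral_mono fun t => ?_
        rw [← mul_pow]
        gcongr
        rw [← enorm_norm z, ← enorm_norm (classicalGrad φ (x + t • z)), ← enorm_mul]
        refine enorm_le_iff_norm_le.2 ?_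
        rw [Real.norm_of_nonneg (by positivity)]
        exact norm_fderiv_apply_le φ _ z

namespace FlowDomain

variable {D : FlowDomain d} {φ : Vec d → Vec d}

/-- Integrate the segment bound in `x` and exchange the integrals: by translation invariance the
inner integral does not depend on `t`. The left side uses the ambient measure because shifted points
may leave `Ω`. -/
theorem IsTestField.lintegral_enorm_sq_add_sub_le (hφ : D.IsTestField φ) (z : Vec d) :
    ∫⁻ x, ‖φ (x + z) - φ x‖ₑ ^ 2 ∂D.ambient ≤
      ‖z‖ₑ ^ 2 * ∫⁻ x, ‖classicalGrad φ x‖ₑ ^ 2 ∂D.measure := by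
  have hcont : Continuous (classicalGrad φ) := hφ.continuous_classicalGrad
  calc ∫⁻ x, ‖φ (x + z) - φ x‖ₑ ^ 2 ∂D.ambient
      ≤ ∫⁻ x, (∫⁻ t in Ioc (0 : ℝ) 1, ‖z‖ₑ ^ 2 * ‖classicalGrad φ (x + t • z)‖ₑ ^ 2)
          ∂D.ambient := lintegral_mono fun x => enorm_sq_add_sub_le hφ.contDiff x z
    _ = ∫⁻ t in Ioc (0 : ℝ) 1, (∫⁻ x, ‖z‖ₑ ^ 2 * ‖classicalGrad φ (x + t • z)‖ₑ ^ 2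
          ∂D.ambient) := by
        refine lintegral_lintegral_swap ?_
        refine Measurable.aemeasurable ?_
        refine measurable_const.mul (Measurable.pow_const (β := ℝ≥0∞) ?_ 2)
        exact (hcont.comp (by fun_prop :
          Continuous fun p : Vec d × ℝ => p.1 + p.2 • z)).enorm.measurable
    _ = ∫⁻ t in Ioc (0 : ℝ) 1, ‖z‖ₑ ^ 2 * ∫⁻ x, ‖classicalGrad φ x‖ₑ ^ 2 ∂D.measure := by
        refine lintegral_congr fun t => ?_
        have h := lintegral_ambient_add (hφ.isPeriodic_classicalGrad.comp
          fun y => ‖z‖ₑ ^ 2 * ‖y‖ₑ ^ 2) (t • z)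
        rw [h, lintegral_const_mul _ (hcont.enorm.measurable.pow_const 2),
          lintegral_ambient_eq (hφ.vanishesOutside_classicalGrad.comp
            (fun _ y => ‖y‖ₑ ^ 2) fun _ => by simp)]
    _ = _ := by simp

/-- With compact support this is integration by parts against the constant `1`. On the torus, `t ↦ ∫
G(x + t z)` is constant by invariance, and its derivative at `0` is taken under the integral. -/
theorem integral_fderiv_ambient_eq_zero {G : Vec d → ℝ} (hG : ContDiff ℝ ∞ G)
    (hper : D.IsPeriodic G)
    (hsupp : ∀ Ω h₁ h₂ h₃, D = dirichlet Ω h₁ h₂ h₃ → HasCompactSupport G) (z : Vec d) :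
    ∫ x, fderiv ℝ G x z ∂D.ambient = 0 := by
  have hGd : Differentiable ℝ G := hG.differentiable (by simp)
  have hcont : Continuous fun x => fderiv ℝ G x z :=
    (hG.continuous_fderiv (by simp)).clm_apply continuous_const
  cases D with
  | dirichlet Ω h₁ h₂ h₃ =>
    have hs := hsupp Ω h₁ h₂ h₃ rfl
    have hi : Integrable G volume := hG.continuous.integrable_of_hasCompactSupport hs
    have hi' : Integrable (fun x => fderiv ℝ G x z) volume :=
      hcont.integrable_of_hasCompactSupport (hs.fderiv_apply ℝ z)
    have := integral_mul_fderiv_eq_neg_fderiv_mul_of_integrable (μ := (volume : Measure (Vec d)))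
      (f := fun _ => (1 : ℝ)) (g := G) (v := z) (by simp) (by simpa using hi') (by simpa using hi)
      (fun x _ => differentiableAt_const _) (fun x _ => hGd x)
    simp only [one_mul, fderiv_fun_const, Pi.zero_apply, zero_apply, zero_mul,
      integral_zero, neg_zero] at this
    exact this
  | torus =>
    have hK : IsCompact ((fun p : Vec d × ℝ => p.1 + p.2 • z) ''
        (closure (torus : FlowDomain d).region ×ˢ Metric.closedBall (0 : ℝ) 1)) :=
      ((torus : FlowDomain d).isBounded_region.isCompact_closure.prod
        (isCompact_closedBall _ _)).image (by fun_prop)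
    obtain ⟨C, hC⟩ := hK.exists_bound_of_continuousOn hcont.continuousOn
    have h := (hasDerivAt_integral_of_dominated_loc_of_deriv_le
      (μ := (torus : FlowDomain d).measure) (F := fun (t : ℝ) x => G (x + t • z))
      (F' := fun t x => fderiv ℝ G (x + t • z) z) (x₀ := 0) (bound := fun _ => C)
      (Metric.ball_mem_nhds (0 : ℝ) one_pos)
      (Filter.Eventually.of_forall fun t => (hG.continuous.comp
        (by fun_prop : Continuous fun x : Vec d => x + t • z)).aestronglyMeasurable)
      ((memLp_of_continuous (hG.continuous.comp
        (by fun_prop : Continuous fun x : Vec d => x + (0 : ℝ) • z)) 1).integrable le_rfl)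
      (hcont.comp (by fun_prop : Continuous fun x : Vec d => x + (0 : ℝ) • z)).aestronglyMeasurable
      (by
        filter_upwards [ae_restrict_mem (torus : FlowDomain d).measurableSet_region] with x hx t ht
        exact hC _ ⟨(x, t), ⟨subset_closure hx, Metric.ball_subset_closedBall ht⟩, rfl⟩)
      (integrable_const _)
      (Filter.Eventually.of_forall fun x t _ => by
        have h1 : HasDerivAt (fun t : ℝ => x + t • z) z t := by
          simpa using ((hasDerivAt_id t).smul_const z).const_add x
        exact (hGd (x + t • z)).hasFDerivAt.comp_hasDerivAt t h1)).2
    have hconst : (fun t : ℝ => ∫ x, G (x + t • z) ∂(torus : FlowDomain d).measure) =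
        fun _ => ∫ x, G x ∂(torus : FlowDomain d).measure :=
      funext fun t => integral_ambient_add hper (t • z)
    rw [hconst] at h
    have := h.unique (hasDerivAt_const _ _)
    simp only [zero_smul, add_zero] at this
    exact this

end FlowDomain

/-! ### Grid approximation, Poincaré's inequality and Rellich's theorem. -/

theorem lp_two_enorm_sq {X β : Type*} [MeasurableSpace X] {μ : Measure X}
    [NormedAddCommGroup β] (f : Lp β 2 μ) : ‖f‖ₑ ^ 2 = ∫⁻ x, ‖f x‖ₑ ^ 2 ∂μ := by
  have h := eLpNorm_nnreal_pow_eq_lintegral (f := f) (μ := μ) (p := 2) two_ne_zero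
  rw [Lp.enorm_def]
  simpa using h

/-- The index of the cell containing `x` in the cubic grid of mesh size `h`. -/
noncomputable def gridIndex (h : ℝ) (x : Vec d) : Fin d → ℤ := fun i => ⌊x i / h⌋

theorem measurable_gridIndex (h : ℝ) : Measurable (gridIndex h : Vec d → Fin d → ℤ) :=
  measurable_pi_lambda _ fun i =>
    Int.measurable_floor.comp ((by fun_prop : Measurable fun x : Vec d => x i).div_const h)

/-- The corner of a cell of the cubic grid of mesh size `h`. -/
noncomputable def gridCorner (h : ℝ) (k : Fin d → ℤ) : Vec d := WithLp.toLp 2 fun i => h * k i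

theorem norm_gridCorner_sub_le {h : ℝ} (hh : 0 < h) (x : Vec d) :
    ‖gridCorner h (gridIndex h x) - x‖ ≤ Real.sqrt d * h := by
  refine le_of_sq_le_sq ?_ (by positivity)
  rw [mul_pow, Real.sq_sqrt (by positivity), EuclideanSpace.real_norm_sq_eq]
  calc ∑ i, (gridCorner h (gridIndex h x) - x) i ^ 2 ≤ ∑ _i : Fin d, h ^ 2 := by
        refine Finset.sum_le_sum fun i _ => ?_
        refine sq_le_sq' ?_ ?_
        · have := (div_lt_iff₀ hh).1 (Int.lt_floor_add_one (x i / h))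
          simp only [gridCorner, gridIndex, PiLp.sub_apply]
          nlinarith
        · have := (le_div_iff₀ hh).1 (Int.floor_le (x i / h))
          simp only [gridCorner, gridIndex, PiLp.sub_apply]
          nlinarith
    _ = d * h ^ 2 := by simp

namespace FlowDomain

variable {D : FlowDomain d}

theorem finite_gridIndex_image {s : Set (Vec d)} (hs : Bornology.IsBounded s) {h : ℝ}
    (hh : 0 < h) : (gridIndex h '' s).Finite := by
  obtain ⟨R, hR⟩ := hs.exists_norm_le
  refine (Set.finite_Icc (fun _ : Fin d => ⌊-R / h⌋) (fun _ => ⌊R / h⌋)).subset ?_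
  rintro _ ⟨x, hx, rfl⟩
  have hxi : ∀ i, -R ≤ x i ∧ x i ≤ R := fun i =>
    abs_le.1 ((PiLp.norm_apply_le x i).trans (hR x hx))
  exact ⟨fun i => Int.floor_le_floor (by gcongr; exact (hxi i).1),
    fun i => Int.floor_le_floor (by gcongr; exact (hxi i).2)⟩

/-- On each cell take the value of `φ` at the corner shifted by a common vector `s`. The error
averaged over `s` in a ball of radius `h` is controlled by the translation estimate, so some `s`
does at least as well as the average. No pointwise control of `φ` by its `H¹` norm is used. -/
theorem IsTestField.exists_grid_approximation {φ : Vec d → Vec d} (hφ : D.IsTestField φ) {h : ℝ}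
    (hh : 0 < h) : ∃ c : (Fin d → ℤ) → Vec d,
      ∫⁻ x, ‖φ x - c (gridIndex h x)‖ₑ ^ 2 ∂D.measure ≤
        ENNReal.ofReal ((Real.sqrt d + 1) ^ (d + 2) * h ^ 2) *
          ∫⁻ x, ‖classicalGrad φ x‖ₑ ^ 2 ∂D.measure := by
  -- A point is within `√d * h` of its corner and the shift adds at most `h`, so all displacements
  -- have length at most `ρ * h`. The factor `ρ ^ d` comes from the volume ratio of `B` to `S`, and
  -- `ρ ^ 2 * h ^ 2` from the translation estimate.
  set ρ : ℝ := Real.sqrt d + 1 with hρ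
  have hρ0 : 0 < ρ := by positivity
  set N : ℝ≥0∞ := ∫⁻ x, ‖classicalGrad φ x‖ₑ ^ 2 ∂D.measure with hN
  set r : Vec d → Vec d := fun x => gridCorner h (gridIndex h x) with hr
  set S : Set (Vec d) := Metric.closedBall 0 h with hS
  set B : Set (Vec d) := Metric.closedBall 0 (ρ * h) with hB
  have hrm : Measurable r :=
    (Measurable.of_discrete (f := gridCorner h)).comp (measurable_gridIndex h)
  have hS0 : volume S ≠ 0 := (Metric.measure_closedBall_pos volume 0 hh).ne'
  have hS1 : volume S ≠ ⊤ := measure_closedBall_lt_top.ne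
  have hBS : volume B = ENNReal.ofReal (ρ ^ d) * volume S := by
    rw [hB, Measure.addHaar_closedBall_mul _ _ hρ0.le hh.le, finrank_euclideanSpace_fin]
  have hmeas : Measurable fun p : Vec d × Vec d => ‖φ p.2 - φ (r p.2 + p.1)‖ₑ ^ 2 := by
    refine Measurable.pow_const (β := ℝ≥0∞) (Measurable.enorm (Measurable.sub ?_ ?_)) 2
    · exact hφ.continuous.measurable.comp measurable_snd
    · exact hφ.continuous.measurable.comp ((hrm.comp measurable_snd).add measurable_fst)
  have hmeas' : Measurable fun p : Vec d × Vec d => ‖φ (p.1 + p.2) - φ p.1‖ₑ ^ 2 := by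
    refine Measurable.pow_const (β := ℝ≥0∞) (Measurable.enorm (Measurable.sub ?_ ?_)) 2
    · exact hφ.continuous.measurable.comp measurable_add
    · exact hφ.continuous.measurable.comp measurable_fst
  have hpt : ∀ x, ∫⁻ s in S, ‖φ x - φ (r x + s)‖ₑ ^ 2 ≤
      ∫⁻ z in B, ‖φ (x + z) - φ x‖ₑ ^ 2 := by
    intro x
    have hBm : MeasurableSet B := Metric.isClosed_closedBall.measurableSet
    have hSm : MeasurableSet S := Metric.isClosed_closedBall.measurableSet
    -- Change of variable `z = s + (r x - x)`, which maps `S` into `B`.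
    rw [← lintegral_indicator hSm, ← lintegral_indicator hBm,
      ← lintegral_add_right_eq_self (B.indicator fun z => ‖φ (x + z) - φ x‖ₑ ^ 2) (r x - x)]
    refine lintegral_mono fun s => ?_
    by_cases hs : s ∈ S
    swap
    · rw [indicator_of_notMem hs]
      exact bot_le
    have hmem : s + (r x - x) ∈ B := by
      rw [hB, mem_closedBall_zero_iff, hρ, add_mul, one_mul, add_comm]
      exact (norm_add_le _ _).trans
        (add_le_add (norm_gridCorner_sub_le hh x) (mem_closedBall_zero_iff.1 hs))
    rw [indicator_of_mem hs, indicator_of_mem hmem, show x + (s + (r x - x)) = r x + s by abel, ← enorm_neg,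
      neg_sub]
  have htotal : ∫⁻ s in S, ∫⁻ x, ‖φ x - φ (r x + s)‖ₑ ^ 2 ∂D.ambient ≤
      volume B * (ENNReal.ofReal ((ρ * h) ^ 2) * N) := by
    calc ∫⁻ s in S, ∫⁻ x, ‖φ x - φ (r x + s)‖ₑ ^ 2 ∂D.ambient
        = ∫⁻ x, (∫⁻ s in S, ‖φ x - φ (r x + s)‖ₑ ^ 2) ∂D.ambient :=
          lintegral_lintegral_swap hmeas.aemeasurable
      _ ≤ ∫⁻ x, (∫⁻ z in B, ‖φ (x + z) - φ x‖ₑ ^ 2) ∂D.ambient := lintegral_mono hpt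
      _ = ∫⁻ z in B, ∫⁻ x, ‖φ (x + z) - φ x‖ₑ ^ 2 ∂D.ambient :=
          lintegral_lintegral_swap hmeas'.aemeasurable
      _ ≤ ∫⁻ z in B, ENNReal.ofReal ((ρ * h) ^ 2) * N := by
          refine setLIntegral_mono measurable_const fun z hz => ?_
          refine (hφ.lintegral_enorm_sq_add_sub_le z).trans ?_
          gcongr
          rw [← ofReal_norm, ← ENNReal.ofReal_pow (norm_nonneg z)]
          gcongr
          exact mem_closedBall_zero_iff.1 hz
      _ = _ := by rw [setLIntegral_const, mul_comm]
  obtain ⟨s, -, hs⟩ := exists_le_setLAverage hS0 hS1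
    (hmeas.lintegral_prod_right' (ν := D.ambient)).aemeasurable
  refine ⟨fun k => φ (gridCorner h k + s), ?_⟩
  calc ∫⁻ x, ‖φ x - φ (gridCorner h (gridIndex h x) + s)‖ₑ ^ 2 ∂D.measure
      ≤ ∫⁻ x, ‖φ x - φ (r x + s)‖ₑ ^ 2 ∂D.ambient := lintegral_mono' D.measure_le_ambient le_rfl
    _ ≤ (∫⁻ s in S, ∫⁻ x, ‖φ x - φ (r x + s)‖ₑ ^ 2 ∂D.ambient) / volume S := by
        rwa [setLAverage_eq] at hs
    _ ≤ (volume B * (ENNReal.ofReal ((ρ * h) ^ 2) * N)) / volume S := by gcongr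
    _ = _ := by
        rw [hBS, mul_comm (ENNReal.ofReal (ρ ^ d)), mul_assoc, mul_div_assoc,
          ENNReal.mul_div_cancel hS0 hS1, ← mul_assoc, ← ENNReal.ofReal_mul (by positivity)]
        congr 2
        ring

theorem IsTestField.enorm_pair_fst_sq {φ : Vec d → Vec d} (hφ : D.IsTestField φ) :
    ‖hφ.pair.fst‖ₑ ^ 2 = ∫⁻ x, ‖φ x‖ₑ ^ 2 ∂D.measure := by
  rw [lp_two_enorm_sq]
  exact lintegral_congr_ae (hφ.pair_fst_ae.fun_comp fun y => ‖y‖ₑ ^ 2)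

theorem IsTestField.enorm_pair_snd_sq {φ : Vec d → Vec d} (hφ : D.IsTestField φ) :
    ‖hφ.pair.snd‖ₑ ^ 2 = ∫⁻ x, ‖classicalGrad φ x‖ₑ ^ 2 ∂D.measure := by
  rw [lp_two_enorm_sq]
  exact lintegral_congr_ae (hφ.pair_snd_ae.fun_comp fun y => ‖y‖ₑ ^ 2)

theorem norm_le_of_enorm_sq_le {β γ : Type*} [NormedAddCommGroup β] [NormedAddCommGroup γ]
    {C : ℝ} (hC : 0 ≤ C) {f : β} {g : γ} (h : ‖f‖ₑ ^ 2 ≤ ENNReal.ofReal (C ^ 2) * ‖g‖ₑ ^ 2) :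
    ‖f‖ ≤ C * ‖g‖ := by
  refine le_of_sq_le_sq ?_ (by positivity)
  rw [← ofReal_norm, ← ofReal_norm, ← ENNReal.ofReal_pow (norm_nonneg _),
    ← ENNReal.ofReal_pow (norm_nonneg _), ← ENNReal.ofReal_mul (by positivity),
    ENNReal.ofReal_le_ofReal_iff (by positivity)] at h
  rwa [mul_pow]

/-- **Poincaré's inequality.** -/
theorem exists_poincare (hd : 0 < d) (D : FlowDomain d) :
    ∃ C : ℝ, 0 < C ∧ ∀ w ∈ D.sobolev, ‖w.fst‖ ≤ C * ‖w.snd‖ := by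
  suffices h : ∃ C : ℝ, 0 < C ∧ ∀ φ : Vec d → Vec d, ∀ hφ : D.IsTestField φ,
      ‖hφ.pair.fst‖ ≤ C * ‖hφ.pair.snd‖ by
    obtain ⟨C, hC, h⟩ := h
    refine ⟨C, hC, fun w hw => sobolev_induction (p := fun w => ‖w.fst‖ ≤ C * ‖w.snd‖) ?_ h hw⟩
    exact isClosed_le (WithLp.continuous_fst 2 _ _).norm
      (continuous_const.mul (WithLp.continuous_snd 2 _ _).norm)
  cases D with
  | dirichlet Ω h₁ h₂ h₃ =>
    obtain ⟨R, hR⟩ := h₂.exists_norm_le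
    obtain ⟨x₀, hx₀⟩ := h₃
    have hR0 : 0 ≤ R := (norm_nonneg x₀).trans (hR x₀ hx₀)
    -- A shift longer than the diameter bound `2 * R` moves every point of `Ω` outside it, where `φ`
    -- vanishes; the difference `φ (x + z) - φ x` is then `-φ x`.
    refine ⟨2 * R + 1, by positivity, fun φ hφ => ?_⟩
    refine norm_le_of_enorm_sq_le (by positivity) ?_
    set z : Vec d := EuclideanSpace.single ⟨0, hd⟩ (2 * R + 1) with hz
    have hzn : ‖z‖ = 2 * R + 1 := by
      rw [hz, PiLp.norm_single, Real.norm_of_nonneg (by positivity)]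
    rw [hφ.enorm_pair_fst_sq, hφ.enorm_pair_snd_sq, ENNReal.ofReal_pow (by positivity), ← hzn,
      ofReal_norm]
    refine le_trans ?_ (hφ.lintegral_enorm_sq_add_sub_le z)
    refine le_trans ?_ (lintegral_mono' (measure_le_ambient _) le_rfl)
    refine setLIntegral_mono' (measurableSet_region _) fun x hx => ?_
    have hxz : x + z ∉ Ω := by
      intro h
      have h1 := hR _ h
      have h2 := hR _ hx
      have h3 := norm_sub_le (x + z) x
      rw [add_sub_cancel_left, hzn] at h3
      linarith
    rw [hφ.vanishesOutside _ hxz, zero_sub, enorm_neg]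
  | torus =>
    refine ⟨Real.sqrt ((Real.sqrt d + 1) ^ (d + 2) * (2 * Real.pi) ^ 2), ?_, fun φ hφ => ?_⟩
    · exact Real.sqrt_pos.2 (mul_pos (by positivity) (pow_pos Real.two_pi_pos 2))
    -- With mesh `2π` the torus is a single cell, so the approximation is a constant. Zero mean
    -- makes `φ` orthogonal to constants, so subtracting one can only increase the norm.
    obtain ⟨c, hc⟩ := hφ.exists_grid_approximation Real.two_pi_pos
    have hidx : ∀ x ∈ (torus : FlowDomain d).region, gridIndex (2 * Real.pi) x = 0 := by
      intro x hx
      funext i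
      simp only [gridIndex, Pi.zero_apply, Int.floor_eq_zero_iff]
      exact ⟨div_nonneg (hx i).1 Real.two_pi_pos.le, (div_lt_one Real.two_pi_pos).2 (hx i).2⟩
    set k : (torus : FlowDomain d).L2 := Lp.const 2 _ (c 0) with hk
    have horth : inner ℝ hφ.pair.fst k = 0 := by
      rw [real_inner_comm, L2.inner_def]
      have : (fun x => inner ℝ (k x) (hφ.pair.fst x)) =ᵐ[(torus : FlowDomain d).measure]
          fun x => inner ℝ (c 0) (φ x) := by
        filter_upwards [hφ.pair_fst_ae, Lp.coeFn_const (p := 2)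
          (μ := (torus : FlowDomain d).measure) (c 0)] with x h1 h2
        rw [h1, hk, h2, Function.const_apply]
      rw [integral_congr_ae this, integral_inner ((hφ.memLp 1).integrable le_rfl), hφ.2.2,
        inner_zero_right]
    have h1 : ‖hφ.pair.fst‖ ≤ ‖hφ.pair.fst - k‖ := by
      refine le_of_sq_le_sq ?_ (norm_nonneg _)
      rw [@norm_sub_sq_real, horth]
      nlinarith [sq_nonneg ‖k‖]
    refine h1.trans (norm_le_of_enorm_sq_le (Real.sqrt_nonneg _) ?_)
    rw [Real.sq_sqrt (by positivity), hφ.enorm_pair_snd_sq, lp_two_enorm_sq]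
    refine le_of_eq_of_le (lintegral_congr_ae ?_) hc
    filter_upwards [hφ.pair_fst_ae, Lp.coeFn_const (p := 2)
      (μ := (torus : FlowDomain d).measure) (c 0), Lp.coeFn_sub hφ.pair.fst k,
      ae_restrict_mem (torus : FlowDomain d).measurableSet_region] with x h1 h2 h3 h4
    rw [h3, Pi.sub_apply, h1, hk, h2, Function.const_apply, hidx x h4]

/-- The space `V` consists of step functions on the finitely many grid cells meeting the region. It
depends on `h` alone, and this uniformity in `φ` is what gives compactness. -/
theorem exists_finiteDimensional_approximation (D : FlowDomain d) {h : ℝ} (hh : 0 < h) :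
    ∃ V : Submodule ℝ D.L2, FiniteDimensional ℝ V ∧
      ∀ φ : Vec d → Vec d, ∀ hφ : D.IsTestField φ, ∃ v ∈ V,
        ‖hφ.pair.fst - v‖ ≤ Real.sqrt ((Real.sqrt d + 1) ^ (d + 2)) * h * ‖hφ.pair.snd‖ := by
  classical
  set K : Set (Fin d → ℤ) := gridIndex h '' D.region with hK
  have : Finite K := finite_gridIndex_image D.isBounded_region hh
  have : Fintype K := Fintype.ofFinite K
  let f : (K → Vec d) → Vec d → Vec d := fun c x =>
    if hx : gridIndex h x ∈ K then c ⟨gridIndex h x, hx⟩ else 0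
  have hf : ∀ c, MemLp (f c) 2 D.measure := by
    intro c
    refine MemLp.of_bound (C := ‖c‖) ?_ (.of_forall fun x => ?_)
    · exact ((Measurable.of_discrete (f := fun k : Fin d → ℤ =>
        if hx : k ∈ K then c ⟨k, hx⟩ else 0)).comp (measurable_gridIndex h)).aestronglyMeasurable
    · by_cases hx : gridIndex h x ∈ K
      · simpa only [f, dif_pos hx] using norm_le_pi_norm c _
      · simp only [f, dif_neg hx, norm_zero, norm_nonneg]
  let L : (K → Vec d) →ₗ[ℝ] D.L2 :=
    { toFun := fun c => (hf c).toLp (f c)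
      map_add' := fun c c' => by
        rw [← MemLp.toLp_add]
        refine MemLp.toLp_congr _ _ (.of_forall fun x => ?_)
        by_cases hx : gridIndex h x ∈ K <;> simp [f, hx]
      map_smul' := fun a c => by
        rw [RingHom.id_apply, ← MemLp.toLp_const_smul]
        refine MemLp.toLp_congr _ _ (.of_forall fun x => ?_)
        by_cases hx : gridIndex h x ∈ K <;> simp [f, hx] }
  refine ⟨LinearMap.range L, inferInstance, fun φ hφ => ?_⟩
  obtain ⟨c, hc⟩ := hφ.exists_grid_approximation hh
  refine ⟨L fun k => c k, LinearMap.mem_range_self _ _, norm_le_of_enorm_sq_le (by positivity) ?_⟩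
  rw [mul_pow, Real.sq_sqrt (by positivity), hφ.enorm_pair_snd_sq, lp_two_enorm_sq]
  refine le_of_eq_of_le (lintegral_congr_ae ?_) hc
  have hL : (L fun k => c k : Vec d → Vec d) =ᵐ[D.measure] f fun k => c k :=
    MemLp.coeFn_toLp (hf fun k => c k)
  filter_upwards [hφ.pair_fst_ae, hL, Lp.coeFn_sub hφ.pair.fst (L fun k => c k),
    ae_restrict_mem D.measurableSet_region] with x h1 h2 h3 h4
  rw [h3, Pi.sub_apply, h1, h2]
  simp only [f]
  rw [dif_pos (mem_image_of_mem (gridIndex h) h4 : gridIndex h x ∈ K)]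

/-- The embedding of the Sobolev space into `L²`. -/
noncomputable def sobolevToL2 (D : FlowDomain d) : D.sobolev →L[ℝ] D.L2 :=
  (WithLp.fstL 2 ℝ D.L2 (Lp (Mat d) 2 D.measure)).comp D.sobolev.subtypeL

/-- **Rellich's theorem.** -/
theorem isCompactOperator_sobolevToL2 (D : FlowDomain d) : IsCompactOperator D.sobolevToL2 := by
  set C : ℝ := Real.sqrt ((Real.sqrt d + 1) ^ (d + 2)) with hC
  have key : ∀ n : ℕ, ∃ P : D.sobolev →L[ℝ] D.L2, IsCompactOperator P ∧
      ‖P - D.sobolevToL2‖ ≤ C * (1 / ((n : ℝ) + 1)) := by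
    intro n
    have hh : 0 < 1 / ((n : ℝ) + 1) := Nat.one_div_pos_of_nat
    obtain ⟨V, hV, hVapprox⟩ := D.exists_finiteDimensional_approximation hh
    -- The embedding is a norm limit of finite-rank operators: orthogonal projection onto `V` is at
    -- least as good as the step-function approximant.
    refine ⟨V.starProjection.comp D.sobolevToL2, ?_, ?_⟩
    · have hid : IsCompactOperator (id : V → V) := isCompactOperator_id_iff_finiteDimensional.2 hV
      exact (hid.comp_clm (V.orthogonalProjectionOnto.comp D.sobolevToL2)).clm_comp V.subtypeL
    · refine ContinuousLinearMap.opNorm_le_bound _ (by positivity) fun w => ?_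
      have hw : ‖V.starProjection w.1.fst - w.1.fst‖ ≤ C * (1 / ((n : ℝ) + 1)) * ‖w.1.snd‖ := by
        refine sobolev_induction (p := fun w : D.Pair => ‖V.starProjection w.fst - w.fst‖ ≤
          C * (1 / ((n : ℝ) + 1)) * ‖w.snd‖) ?_ (fun φ hφ => ?_) w.2
        · have hc := WithLp.continuous_fst 2 D.L2 (Lp (Mat d) 2 D.measure)
          exact isClosed_le ((V.starProjection.continuous.comp hc).sub hc).norm
            (continuous_const.mul (WithLp.continuous_snd 2 _ _).norm)
        · obtain ⟨v, hv, hv'⟩ := hVapprox φ hφ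
          refine le_trans ?_ hv'
          rw [norm_sub_rev, Submodule.starProjection_minimal]
          exact ciInf_le ⟨0, by rintro _ ⟨y, rfl⟩; exact norm_nonneg _⟩ (⟨v, hv⟩ : V)
      refine hw.trans ?_
      gcongr
      exact WithLp.norm_snd_le (p := 2) (x := (w : D.Pair))
  choose P hP hPle using key
  refine isCompactOperator_of_tendsto (l := Filter.atTop) (F := P) ?_ (.of_forall hP)
  refine (tendsto_iff_norm_sub_tendsto_zero (E := D.sobolev →L[ℝ] D.L2)).2 ?_
  refine squeeze_zero (fun n => (P n - D.sobolevToL2).opNorm_nonneg) hPle ?_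
  simpa using tendsto_one_div_add_atTop_nhds_zero_nat.const_mul C

end FlowDomain

/-! ### The embedding of `H¹` into `L⁴`. -/

theorem eLpNorm_restrict_of_forall_notMem {X β : Type*} [MeasurableSpace X] {μ : Measure X}
    [NormedAddCommGroup β] {f : X → β} {s : Set X} (h : ∀ x, x ∉ s → ‖f x‖ = 0) (p : ℝ≥0∞) :
    eLpNorm f p (μ.restrict s) = eLpNorm f p μ := by
  rw [← eLpNorm_norm, ← eLpNorm_norm f]
  refine eLpNorm_restrict_eq_of_support_subset fun x hx => ?_
  by_contra hxs
  exact hx (h x hxs)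

/-- The exponent `12/7` serves both dimensions: it is below `2`, as the inequality needs when `d =
2`, and its Sobolev conjugate is `12` for `d = 2` and exactly `4` for `d = 3`. Hölder's inequality
on the bounded support then replaces `12/7` by `2`. -/
theorem exists_gagliardo_nirenberg_four (hd : d = 2 ∨ d = 3) {s : Set (Vec d)}
    (hs : Bornology.IsBounded s) : ∃ C : ℝ≥0, ∀ ψ : Vec d → Vec d, ContDiff ℝ 1 ψ →
      Function.support ψ ⊆ s → eLpNorm ψ 4 volume ≤ C * eLpNorm (fderiv ℝ ψ) 2 volume := by
  have hvol : volume (closure s) ≠ ⊤ := hs.isCompact_closure.measure_lt_top.ne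
  have hvol' : volume (closure s) ^ (1 / ((12 / 7 : ℝ≥0) : ℝ≥0∞).toReal - 1 / (2 : ℝ≥0∞).toReal)
      ≠ ⊤ := by
    refine ENNReal.rpow_ne_top_of_nonneg ?_ hvol
    rw [ENNReal.coe_toReal]
    norm_num
  refine ⟨eLpNormLESNormFDerivOfLeConst (Vec d) (volume : Measure (Vec d)) s (12 / 7) 4 *
    (volume (closure s) ^ (1 / ((12 / 7 : ℝ≥0) : ℝ≥0∞).toReal -
      1 / (2 : ℝ≥0∞).toReal)).toNNReal, fun ψ hψ hsupp => ?_⟩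
  have hp1 : (1 : ℝ≥0) ≤ 12 / 7 := by
    rw [← NNReal.coe_le_coe]; push_cast; norm_num
  have h := eLpNorm_le_eLpNorm_fderiv_of_le (volume : Measure (Vec d)) hψ hsupp (p := 12 / 7)
    (q := 4) hp1
    (by
      rw [finrank_euclideanSpace_fin, ← NNReal.coe_lt_coe]
      rcases hd with rfl | rfl <;> push_cast <;> norm_num)
    (by rw [finrank_euclideanSpace_fin]; rcases hd with rfl | rfl <;> push_cast <;> norm_num) hs
  have hsupp' : ∀ x, x ∉ closure s → ‖fderiv ℝ ψ x‖ = 0 := fun x hx => by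
    by_contra h
    exact hx (closure_mono hsupp (support_fderiv_subset ℝ (norm_ne_zero_iff.1 h)))
  have h2 : eLpNorm (fderiv ℝ ψ) ((12 / 7 : ℝ≥0) : ℝ≥0∞) volume ≤
      eLpNorm (fderiv ℝ ψ) 2 volume * volume (closure s) ^
        (1 / ((12 / 7 : ℝ≥0) : ℝ≥0∞).toReal - 1 / (2 : ℝ≥0∞).toReal) := by
    rw [← eLpNorm_restrict_of_forall_notMem hsupp', ← eLpNorm_restrict_of_forall_notMem hsupp' 2]
    have h3 := eLpNorm_le_eLpNorm_mul_rpow_measure_univ (μ := volume.restrict (closure s))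
      (f := fderiv ℝ ψ) (p := ((12 / 7 : ℝ≥0) : ℝ≥0∞)) (q := 2)
      (by
        rw [show (2 : ℝ≥0∞) = ((2 : ℝ≥0) : ℝ≥0∞) by simp, ENNReal.coe_le_coe,
          ← NNReal.coe_le_coe]
        push_cast; norm_num)
      (hψ.continuous_fderiv one_ne_zero).aestronglyMeasurable
    rwa [Measure.restrict_apply_univ] at h3
  rw [ENNReal.coe_mul, ENNReal.coe_toNNReal hvol', mul_assoc]
  refine le_trans (by simpa using h) ?_
  gcongr
  rw [mul_comm]
  simpa using h2

namespace FlowDomain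

variable {D : FlowDomain d}

/-- Here `n` is the number of period cells that meet `s`; each of them contributes the same
integral. -/
theorem exists_setLIntegral_periodic_le {s : Set (Vec d)} (hs : Bornology.IsBounded s) :
    ∃ n : ℕ, ∀ F : Vec d → ℝ≥0∞, (torus : FlowDomain d).IsPeriodic F →
      ∫⁻ x in s, F x ≤ n * ∫⁻ x, F x ∂(torus : FlowDomain d).measure := by
  classical
  set K : Set (Fin d → ℤ) := gridIndex (2 * Real.pi) '' s with hK
  have : Finite K := finite_gridIndex_image hs Real.two_pi_pos
  have : Fintype K := Fintype.ofFinite K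
  refine ⟨Fintype.card K, fun F hF => ?_⟩
  have hcover : s ⊆ ⋃ k : K, (fun x => x + gridCorner (2 * Real.pi) k) ''
      (torus : FlowDomain d).region := by
    intro x hx
    refine mem_iUnion.2 ⟨⟨gridIndex (2 * Real.pi) x, mem_image_of_mem _ hx⟩,
      x - gridCorner (2 * Real.pi) (gridIndex (2 * Real.pi) x), fun i => ?_, sub_add_cancel _ _⟩
    have h1 := (le_div_iff₀ Real.two_pi_pos).1 (Int.floor_le (x i / (2 * Real.pi)))
    have h2 := (div_lt_iff₀ Real.two_pi_pos).1 (Int.lt_floor_add_one (x i / (2 * Real.pi)))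
    simp only [gridCorner, gridIndex, PiLp.sub_apply, mem_Ico]
    constructor <;> linarith
  have hcell : ∀ k : K, ∫⁻ x in (fun x => x + gridCorner (2 * Real.pi) k) ''
      (torus : FlowDomain d).region, F x = ∫⁻ x, F x ∂(torus : FlowDomain d).measure := by
    intro k
    rw [← (measurePreserving_add_right (volume : Measure (Vec d)) _).setLIntegral_comp_emb
      (measurableEmbedding_addRight _) F (torus : FlowDomain d).region]
    exact lintegral_ambient_add hF _
  calc ∫⁻ x in s, F x ≤ _ := lintegral_mono_set hcover
    _ ≤ _ := lintegral_iUnion_le _ _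
    _ = _ := by simp only [hcell, tsum_fintype, Finset.sum_const, Finset.card_univ, nsmul_eq_mul]

theorem exists_eLpNorm_two_periodic_le {s : Set (Vec d)} (hs : Bornology.IsBounded s) :
    ∃ n : ℕ, ∀ H : Vec d → ℝ, (torus : FlowDomain d).IsPeriodic H →
      eLpNorm H 2 (volume.restrict s) ≤ n * eLpNorm H 2 (torus : FlowDomain d).measure := by
  obtain ⟨n, hn⟩ := exists_setLIntegral_periodic_le hs
  refine ⟨n, fun H hH => ?_⟩
  have hpow : ∀ μ : Measure (Vec d), eLpNorm H 2 μ ^ 2 = ∫⁻ x, ‖H x‖ₑ ^ 2 ∂μ := fun μ => by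
    simpa using eLpNorm_nnreal_pow_eq_lintegral (f := H) (μ := μ) (p := 2) two_ne_zero
  refine (ENNReal.pow_le_pow_left_iff two_ne_zero).1 ?_
  rw [mul_pow, hpow, hpow]
  refine (hn _ (hH.comp fun y => ‖y‖ₑ ^ 2)).trans ?_
  gcongr
  exact_mod_cast Nat.le_self_pow two_ne_zero n

theorem exists_eLpNorm_four_testField_le (hd : d = 2 ∨ d = 3) (D : FlowDomain d) :
    ∃ C : ℝ≥0, ∀ φ : Vec d → Vec d, ∀ hφ : D.IsTestField φ,
      eLpNorm φ 4 D.measure ≤ C * (‖hφ.pair.fst‖ₑ + ‖hφ.pair.snd‖ₑ) := by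
  have hfst : ∀ φ : Vec d → Vec d, ∀ hφ : D.IsTestField φ,
      ‖hφ.pair.fst‖ₑ = eLpNorm φ 2 D.measure := fun φ hφ => by
    rw [Lp.enorm_def, eLpNorm_congr_ae hφ.pair_fst_ae]
  have hsnd : ∀ φ : Vec d → Vec d, ∀ hφ : D.IsTestField φ,
      ‖hφ.pair.snd‖ₑ = eLpNorm (classicalGrad φ) 2 D.measure := fun φ hφ => by
    rw [Lp.enorm_def, eLpNorm_congr_ae hφ.pair_snd_ae]
  cases D with
  | dirichlet Ω h₁ h₂ h₃ =>
    obtain ⟨C, hC⟩ := exists_gagliardo_nirenberg_four hd h₂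
    refine ⟨C, fun φ hφ => ?_⟩
    have hsupp : Function.support φ ⊆ Ω := fun x hx => by
      by_contra h
      exact hx (hφ.vanishesOutside x h)
    have hgsupp : Function.support (classicalGrad φ) ⊆ Ω := fun x hx => by
      by_contra h
      exact hx (hφ.vanishesOutside_classicalGrad x h)
    calc eLpNorm φ 4 (dirichlet Ω h₁ h₂ h₃).measure ≤ eLpNorm φ 4 volume :=
          eLpNorm_mono_measure _ Measure.restrict_le_self
      _ ≤ C * eLpNorm (fderiv ℝ φ) 2 volume := hC φ (hφ.contDiff.of_le (by simp)) hsupp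
      _ ≤ C * eLpNorm (classicalGrad φ) 2 volume := by
          gcongr
          exact eLpNorm_mono (norm_fderiv_le_norm_classicalGrad φ)
      _ = C * ‖hφ.pair.snd‖ₑ := by
          rw [hsnd, ← eLpNorm_restrict_eq_of_support_subset hgsupp]
          rfl
      _ ≤ _ := by gcongr; exact le_add_self
  | torus =>
    obtain ⟨R, hR, hRr⟩ := (torus : FlowDomain d).isBounded_region.exists_pos_norm_le
    -- Periodic fields lack compact support, so the inequality is applied to `χ φ` with a cutoff
    -- equal to `1` on the period cell. Periodicity then bounds the norm over the larger ball by the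
    -- norm over one cell.
    let χ : ContDiffBump (0 : Vec d) := ⟨R, R + 1, hR, lt_add_one R⟩
    set s : Set (Vec d) := Metric.closedBall 0 (R + 1) with hs
    have hχs : tsupport χ = s := χ.tsupport_eq
    have hχd : ContDiff ℝ 1 χ := χ.contDiff (n := 1)
    obtain ⟨M, hM⟩ := (χ.hasCompactSupport.fderiv (𝕜 := ℝ)).exists_bound_of_continuous
      (hχd.continuous_fderiv one_ne_zero)
    have hM0 : 0 ≤ M := (norm_nonneg _).trans (hM 0)
    obtain ⟨C, hC⟩ := exists_gagliardo_nirenberg_four hd (Metric.isBounded_closedBall (x := 0)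
      (r := R + 1))
    obtain ⟨n, hn⟩ := exists_eLpNorm_two_periodic_le (Metric.isBounded_closedBall
      (x := (0 : Vec d)) (r := R + 1))
    refine ⟨C * ((M + 1).toNNReal * n), fun φ hφ => ?_⟩
    set ψ : Vec d → Vec d := fun x => χ x • φ x with hψ
    have hφ1 : ContDiff ℝ 1 φ := hφ.contDiff.of_le (by simp)
    have hψsupp : Function.support ψ ⊆ s := fun x hx => by
      rw [← hχs]
      refine subset_tsupport _ fun h => hx ?_
      simp [hψ, h]
    have hψd : ContDiff ℝ 1 ψ := hχd.smul hφ1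
    have hψs : ∀ x, x ∉ s → ‖fderiv ℝ ψ x‖ = 0 := fun x hx => by
      by_contra h
      exact hx (closure_minimal hψsupp Metric.isClosed_closedBall
        (support_fderiv_subset ℝ (norm_ne_zero_iff.1 h)))
    set H : Vec d → ℝ := fun x => ‖φ x‖ + ‖classicalGrad φ x‖ with hH
    have hbound : ∀ x, ‖fderiv ℝ ψ x‖ ≤ (M + 1) * ‖H x‖ := by
      intro x
      rw [hψ, fderiv_fun_smul (hχd.differentiable one_ne_zero x)
        (hφ1.differentiable one_ne_zero x), hH, Real.norm_of_nonneg (by positivity)]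
      refine (norm_add_le _ _).trans ?_
      rw [norm_smul, ContinuousLinearMap.norm_smulRight_apply, Real.norm_of_nonneg χ.nonneg]
      have h1 := mul_le_mul (χ.le_one (x := x)) (norm_fderiv_le_norm_classicalGrad φ x) (norm_nonneg _)
        zero_le_one
      have h2 := mul_le_mul_of_nonneg_right (hM x) (norm_nonneg (φ x))
      have h3 := mul_nonneg hM0 (norm_nonneg (classicalGrad φ x))
      have h4 := norm_nonneg (φ x)
      linarith
    have hHper : (torus : FlowDomain d).IsPeriodic H :=
      hφ.isPeriodic.comp₂ hφ.isPeriodic_classicalGrad fun y z => ‖y‖ + ‖z‖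
    calc eLpNorm φ 4 (torus : FlowDomain d).measure
        = eLpNorm ψ 4 (torus : FlowDomain d).measure := by
          refine eLpNorm_congr_ae ?_
          filter_upwards [ae_restrict_mem (torus : FlowDomain d).measurableSet_region] with x hx
          have : χ x = 1 := χ.one_of_mem_closedBall (mem_closedBall_zero_iff.2 (hRr x hx))
          simp [hψ, this]
      _ ≤ eLpNorm ψ 4 volume := eLpNorm_mono_measure _ Measure.restrict_le_self
      _ ≤ C * eLpNorm (fderiv ℝ ψ) 2 volume := hC ψ hψd hψsupp
      _ = C * eLpNorm (fderiv ℝ ψ) 2 (volume.restrict s) := by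
          rw [eLpNorm_restrict_of_forall_notMem hψs]
      _ ≤ C * ((M + 1).toNNReal * eLpNorm H 2 (volume.restrict s)) := by
          gcongr
          refine eLpNorm_le_nnreal_smul_eLpNorm_of_ae_le_mul (.of_forall fun x => ?_) 2
          rw [← NNReal.coe_le_coe]
          push_cast
          rw [Real.coe_toNNReal _ (by positivity)]
          exact hbound x
      _ ≤ C * ((M + 1).toNNReal * (n * eLpNorm H 2 (torus : FlowDomain d).measure)) := by
          gcongr
          exact hn H hHper
      _ ≤ C * ((M + 1).toNNReal * (n * (‖hφ.pair.fst‖ₑ + ‖hφ.pair.snd‖ₑ))) := by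
          gcongr
          rw [hfst, hsnd, ← eLpNorm_norm φ, ← eLpNorm_norm (classicalGrad φ)]
          exact eLpNorm_add_le hφ.continuous.norm.aestronglyMeasurable
            hφ.continuous_classicalGrad.norm.aestronglyMeasurable one_le_two
      _ = _ := by push_cast; simp only [mul_assoc]

/-- The Sobolev embedding `H¹ ⊂ L⁴` in dimension two or three. -/
theorem exists_eLpNorm_four_le (hd : d = 2 ∨ d = 3) (D : FlowDomain d) :
    ∃ C : ℝ≥0, ∀ w ∈ D.sobolev, eLpNorm w.fst 4 D.measure ≤ C * ‖w‖ₑ := by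
  obtain ⟨C, hC⟩ := exists_eLpNorm_four_testField_le hd D
  refine ⟨C * 2, fun w hw => sobolev_induction
    (p := fun w : D.Pair => eLpNorm w.fst 4 D.measure ≤ (C * 2 : ℝ≥0) * ‖w‖ₑ) ?_
    (fun φ hφ => ?_) hw⟩
  -- The `L⁴` norm is not continuous on `L²`, but by Fatou along an almost everywhere convergent
  -- subsequence it is lower semicontinuous, which suffices.
  · refine IsSeqClosed.isClosed fun w w₀ hw hlim => ?_
    have hfst : Filter.Tendsto (fun n => (w n).fst) Filter.atTop (nhds w₀.fst) :=
      ((WithLp.continuous_fst 2 D.L2 (Lp (Mat d) 2 D.measure)).tendsto w₀).comp hlim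
    obtain ⟨ns, hns, hae⟩ := (tendstoInMeasure_of_tendsto_Lp hfst).exists_seq_tendsto_ae
    refine (Lp.eLpNorm_lim_le_liminf_eLpNorm
      (fun n => Lp.aestronglyMeasurable (w (ns n)).fst) _ hae).trans ?_
    have hbd : Filter.Tendsto (fun n => ((C * 2 : ℝ≥0) : ℝ≥0∞) * ‖w (ns n)‖ₑ) Filter.atTop
        (nhds ((C * 2 : ℝ≥0) * ‖w₀‖ₑ)) :=
      ENNReal.Tendsto.const_mul ((continuous_enorm.tendsto w₀).comp
        (hlim.comp hns.tendsto_atTop)) (.inr ENNReal.coe_ne_top)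
    exact (Filter.liminf_le_liminf (.of_forall fun n => hw (ns n))).trans_eq hbd.liminf_eq
  · rw [eLpNorm_congr_ae hφ.pair_fst_ae]
    refine (hC φ hφ).trans ?_
    have h1 : ‖hφ.pair.fst‖ₑ ≤ ‖hφ.pair‖ₑ := WithLp.enorm_fst_le _ _
    have h2 : ‖hφ.pair.snd‖ₑ ≤ ‖hφ.pair‖ₑ := WithLp.enorm_snd_le _ _
    calc (C : ℝ≥0∞) * (‖hφ.pair.fst‖ₑ + ‖hφ.pair.snd‖ₑ) ≤ C * (‖hφ.pair‖ₑ + ‖hφ.pair‖ₑ) := by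
          gcongr
      _ = _ := by push_cast; ring

end FlowDomain

/-! ### The convection term and its cancellation. -/

/-- The tensor product `(u_i v_j)_{i,j}` of two vectors. -/
noncomputable def outer (d : ℕ) : Vec d →L[ℝ] Vec d →L[ℝ] Mat d :=
  LinearMap.mkContinuous₂
    (LinearMap.mk₂ ℝ (fun u v => (WithLp.toLp 2 fun ij : Fin d × Fin d => u ij.1 * v ij.2 : Mat d))
      (fun _ _ _ => by ext; simp [add_mul]) (fun _ _ _ => by ext; simp [mul_assoc])
      (fun _ _ _ => by ext; simp [mul_add]) (fun _ _ _ => by ext; simp [mul_left_comm]))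
    1 fun u v => by
      refine le_of_sq_le_sq ?_ (by positivity)
      rw [one_mul, mul_pow, EuclideanSpace.real_norm_sq_eq, EuclideanSpace.real_norm_sq_eq,
        EuclideanSpace.real_norm_sq_eq, Fintype.sum_prod_type, Finset.sum_mul_sum]
      simp [mul_pow]

@[simp]
theorem outer_apply (u v : Vec d) (i j : Fin d) : outer d u v (i, j) = u i * v j := rfl

/-- The trace of a matrix. -/
noncomputable def matTrace (d : ℕ) : Mat d →L[ℝ] ℝ :=
  ∑ i, EuclideanSpace.proj (𝕜 := ℝ) (i, i)

@[simp]
theorem matTrace_apply (G : Mat d) : matTrace d G = ∑ i, G (i, i) := by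
  simp [matTrace]

/-- The map `G ↦ (tr G) I`. -/
noncomputable def sphericalPart (d : ℕ) : Mat d →L[ℝ] Mat d :=
  (matTrace d).smulRight (WithLp.toLp 2 fun ij => if ij.1 = ij.2 then 1 else 0)

theorem inner_outer (u v : Vec d) (G : Mat d) :
    inner ℝ (outer d u v) G = ∑ i, ∑ j, u i * G (i, j) * v j := by
  rw [PiLp.inner_apply, Fintype.sum_prod_type]
  refine Finset.sum_congr rfl fun i _ => Finset.sum_congr rfl fun j _ => ?_
  simp only [outer_apply, RCLike.inner_apply, conj_trivial]
  ring

theorem inner_outer_self_sphericalPart (u : Vec d) (G : Mat d) :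
    inner ℝ (outer d u u) (sphericalPart d G) = ‖u‖ ^ 2 * ∑ i, G (i, i) := by
  rw [inner_outer, EuclideanSpace.real_norm_sq_eq, Finset.sum_mul]
  refine Finset.sum_congr rfl fun i _ => ?_
  simp only [sphericalPart, ContinuousLinearMap.smulRight_apply, matTrace_apply, PiLp.smul_apply,
    smul_eq_mul, mul_ite, mul_one, mul_zero, ite_mul, zero_mul, Finset.sum_ite_eq,
    Finset.mem_univ, if_true]
  ring

theorem fderiv_coord_mul_norm_sq {φ : Vec d → Vec d} (hφ : Differentiable ℝ φ) (x : Vec d)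
    (i : Fin d) :
    fderiv ℝ (fun x => φ x i * ‖φ x‖ ^ 2) x (EuclideanSpace.single i 1) =
      2 * ∑ j, φ x i * classicalGrad φ x (i, j) * φ x j + ‖φ x‖ ^ 2 * classicalGrad φ x (i, i) := by
  have h1 : HasFDerivAt (fun x => φ x i)
      ((EuclideanSpace.proj (𝕜 := ℝ) i).comp (fderiv ℝ φ x)) x :=
    (EuclideanSpace.proj (𝕜 := ℝ) i).hasFDerivAt.comp x (hφ x).hasFDerivAt
  have h2 := (hφ x).hasFDerivAt.norm_sq
  have h0 : fderiv ℝ (fun x => φ x i * ‖φ x‖ ^ 2) x = _ := (h1.mul h2).fderiv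
  rw [h0]
  have h3 : inner ℝ (φ x) (fderiv ℝ φ x (EuclideanSpace.single i 1)) =
      ∑ j, classicalGrad φ x (i, j) * φ x j := by
    rw [PiLp.inner_apply]
    exact Finset.sum_congr rfl fun j _ => by
      simp only [RCLike.inner_apply, conj_trivial, classicalGrad_apply]
  simp only [add_apply, smul_apply, ContinuousLinearMap.comp_apply, innerSL_apply_apply, h3,
    PiLp.proj_apply, smul_eq_mul, nsmul_eq_mul, Nat.cast_ofNat, classicalGrad_apply,
    mul_assoc, Finset.mul_sum]
  congr 1
  exact Finset.sum_congr rfl fun j _ => by ring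

namespace FlowDomain

variable {D : FlowDomain d}

theorem sobolev_subtype_induction {p : D.sobolev → Prop} (hp : IsClosed {w | p w})
    (htest : ∀ φ : Vec d → Vec d, ∀ hφ : D.IsTestField φ, p ⟨hφ.pair, hφ.pair_mem_sobolev⟩)
    (w : D.sobolev) : p w := by
  obtain ⟨t, ht, hpt⟩ := Topology.IsInducing.subtypeVal.isClosed_iff.1 hp
  have : (w : D.Pair) ∈ t := sobolev_induction (p := fun w => w ∈ t) ht (fun φ hφ => by
    have h : (⟨hφ.pair, hφ.pair_mem_sobolev⟩ : D.sobolev) ∈ {w | p w} := htest φ hφ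
    exact (Set.ext_iff.1 hpt _).2 h) w.2
  have h : w ∈ (Subtype.val ⁻¹' t : Set D.sobolev) := this
  exact (Set.ext_iff.1 hpt w).1 h

theorem exists_embedding_L4 (hd : d = 2 ∨ d = 3) (D : FlowDomain d) [Fact (1 ≤ (4 : ℝ≥0∞))] :
    ∃ J : D.sobolev →L[ℝ] Lp (Vec d) 4 D.measure,
      ∀ w, (J w : Vec d → Vec d) =ᵐ[D.measure] w.1.fst := by
  obtain ⟨C, hC⟩ := exists_eLpNorm_four_le hd D
  have hmem : ∀ w : D.sobolev, MemLp w.1.fst 4 D.measure := fun w =>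
    ⟨Lp.aestronglyMeasurable _, (hC w w.2).trans_lt
      (ENNReal.mul_lt_top ENNReal.coe_lt_top enorm_lt_top)⟩
  refine ⟨LinearMap.mkContinuous
    { toFun := fun w => (hmem w).toLp _
      map_add' := fun v w => by
        rw [← MemLp.toLp_add]
        exact MemLp.toLp_congr _ _ (Lp.coeFn_add v.1.fst w.1.fst)
      map_smul' := fun c w => by
        rw [RingHom.id_apply, ← MemLp.toLp_const_smul]
        exact MemLp.toLp_congr _ _ (Lp.coeFn_smul c w.1.fst) } C fun w => ?_,
    fun w => MemLp.coeFn_toLp (hmem w)⟩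
  have h := hC w w.2
  change ‖(hmem w).toLp _‖ ≤ _
  rw [Lp.norm_toLp]
  refine ENNReal.toReal_le_of_le_ofReal (by positivity) (h.trans_eq ?_)
  rw [ENNReal.ofReal_mul (by positivity), ENNReal.ofReal_coe_nnreal]
  exact congrArg _ (ofReal_norm (w : D.Pair)).symm

/-- Hölder with `1/4 + 1/4 = 1/2`, applied after the embedding into `L⁴`. -/
theorem exists_tensor (hd : d = 2 ∨ d = 3) (D : FlowDomain d) :
    ∃ T : D.sobolev →L[ℝ] D.sobolev →L[ℝ] Lp (Mat d) 2 D.measure,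
      ∀ u v, (T u v : Vec d → Mat d) =ᵐ[D.measure] fun x => outer d (u.1.fst x) (v.1.fst x) := by
  have : Fact ((1 : ℝ≥0∞) ≤ 4) := ⟨by norm_num⟩
  have : ENNReal.HolderTriple 4 4 2 := ⟨by
    rw [← two_mul, show (4 : ℝ≥0∞) = 2 * 2 by norm_num,
      ENNReal.mul_inv (.inl two_ne_zero) (.inl ENNReal.ofNat_ne_top), ← mul_assoc,
      ENNReal.mul_inv_cancel two_ne_zero ENNReal.ofNat_ne_top, one_mul]⟩
  obtain ⟨J, hJ⟩ := exists_embedding_L4 hd D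
  refine ⟨((outer d).holderL D.measure 4 4 2).bilinearComp J J, fun u v => ?_⟩
  have h := (outer d).coeFn_holder (r := 2) (J u) (J v)
  filter_upwards [h, hJ u, hJ v] with x h1 h2 h3
  rw [← h2, ← h3]
  exact h1

/-- The integrand is `∑ ∂_i (φ_i |φ|²)`. The divergence term is kept because solenoidal elements are
limits of test fields that need not be solenoidal. -/
theorem IsTestField.sum_integral_eq_zero {φ : Vec d → Vec d} (hφ : D.IsTestField φ) :
    ∫ x, (2 * inner ℝ (outer d (φ x) (φ x)) (classicalGrad φ x) +
      inner ℝ (outer d (φ x) (φ x)) (sphericalPart d (classicalGrad φ x))) ∂D.measure = 0 := by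
  have hG : ∀ i, ContDiff ℝ ∞ fun x => φ x i * ‖φ x‖ ^ 2 := fun i =>
    ((EuclideanSpace.proj (𝕜 := ℝ) i).contDiff.comp hφ.contDiff).mul (hφ.contDiff.norm_sq ℝ)
  have hzero : ∀ i, ∫ x, fderiv ℝ (fun x => φ x i * ‖φ x‖ ^ 2) x (EuclideanSpace.single i 1)
      ∂D.measure = 0 := by
    intro i
    rw [← integral_ambient_eq]
    · refine integral_fderiv_ambient_eq_zero (hG i)
        (hφ.isPeriodic.comp fun y => y i * ‖y‖ ^ 2) (fun Ω h₁ h₂ h₃ hD => ?_) _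
      subst hD
      exact hφ.2.1.mono fun x hx h => hx (by simp [h])
    · have h1 := hφ.vanishesOutside
      have h2 := hφ.vanishesOutside_classicalGrad
      simp only [fderiv_coord_mul_norm_sq hφ.differentiable]
      cases D with
      | torus => trivial
      | dirichlet Ω _ _ _ => exact fun x hx => by simp [h1 x hx, h2 x hx]
  have hsum : ∀ x, 2 * inner ℝ (outer d (φ x) (φ x)) (classicalGrad φ x) +
      inner ℝ (outer d (φ x) (φ x)) (sphericalPart d (classicalGrad φ x)) =
      ∑ i, fderiv ℝ (fun x => φ x i * ‖φ x‖ ^ 2) x (EuclideanSpace.single i 1) := by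
    intro x
    rw [inner_outer_self_sphericalPart, inner_outer]
    simp only [fderiv_coord_mul_norm_sq hφ.differentiable, Finset.mul_sum, Finset.sum_add_distrib]
  simp only [hsum]
  rw [integral_finsetSum _ fun i _ => (memLp_of_continuous
    (((hG i).continuous_fderiv (by simp)).clm_apply continuous_const) 1).integrable le_rfl]
  exact Finset.sum_eq_zero fun i _ => hzero i

theorem tensor_self_inner_grad
    {T : D.sobolev →L[ℝ] D.sobolev →L[ℝ] Lp (Mat d) 2 D.measure}
    (hT : ∀ u v, (T u v : Vec d → Mat d) =ᵐ[D.measure]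
      fun x => outer d (u.1.fst x) (v.1.fst x)) (u : D.sobolev) :
    2 * inner ℝ (T u u) u.1.snd +
      inner ℝ (T u u) ((sphericalPart d).compLpL 2 D.measure u.1.snd) = 0 := by
  refine sobolev_subtype_induction (p := fun u => 2 * inner ℝ (T u u) u.1.snd +
      inner ℝ (T u u) ((sphericalPart d).compLpL 2 D.measure u.1.snd) = 0) ?_ (fun φ hφ => ?_) u
  · have hsnd : Continuous fun u : D.sobolev => u.1.snd :=
      (WithLp.continuous_snd 2 D.L2 (Lp (Mat d) 2 D.measure)).comp continuous_subtype_val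
    have hTc : Continuous fun u : D.sobolev => T u u := T.continuous.clm_apply continuous_id
    refine isClosed_eq ?_ continuous_const
    exact (continuous_const.mul (hTc.inner hsnd)).add
      (hTc.inner (((sphericalPart d).compLpL 2 D.measure).continuous.comp hsnd))
  · set w : D.sobolev := ⟨hφ.pair, hφ.pair_mem_sobolev⟩ with hw
    have h1 : (T w w : Vec d → Mat d) =ᵐ[D.measure] fun x => outer d (φ x) (φ x) := by
      filter_upwards [hT w w, hφ.pair_fst_ae] with x hx1 hx2
      rw [hx1, ← hx2]
    have h2 : (w.1.snd : Vec d → Mat d) =ᵐ[D.measure] classicalGrad φ := hφ.pair_snd_ae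
    have h3 := (sphericalPart d).coeFn_compLpL (p := 2) (μ := D.measure) w.1.snd
    rw [L2.inner_def, L2.inner_def, ← integral_const_mul, ← integral_add]
    · rw [← hφ.sum_integral_eq_zero]
      refine integral_congr_ae ?_
      filter_upwards [h1, h2, h3] with x hx1 hx2 hx3
      rw [hx3, hx1, hx2]
    · exact (L2.integrable_inner _ _).const_mul 2
    · exact L2.integrable_inner _ _

/-- The inclusion of the solenoidal fields into the Sobolev space. -/
noncomputable def toSobolev (D : FlowDomain d) : D.H1 →L[ℝ] D.sobolev :=
  D.solenoidal.subtypeL.codRestrict D.sobolev fun u => u.2.1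

/-- Boundedness of `T` carries the smooth identity to all Sobolev fields. For a solenoidal field the
spherical part of the gradient vanishes, leaving the cancellation `⟨B(u,u),u⟩ = 0`. -/
theorem exists_convection_tensor (hd : d = 2 ∨ d = 3) (D : FlowDomain d) :
    ∃ T : D.H1 →L[ℝ] D.H1 →L[ℝ] Lp (Mat d) 2 D.measure,
      (∀ u w v, convection u w v = inner ℝ (T u v) (grad w)) ∧
      ∀ u, inner ℝ (T u u) (grad u) = 0 := by
  obtain ⟨T, hT⟩ := exists_tensor hd D
  refine ⟨T.bilinearComp D.toSobolev D.toSobolev, fun u w v => ?_, fun u => ?_⟩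
  · rw [L2.inner_def, convection]
    refine integral_congr_ae ?_
    filter_upwards [hT (D.toSobolev u) (D.toSobolev v)] with x hx
    exact (inner_outer _ _ _).symm.trans (congrArg (fun M => inner ℝ M (grad w x)) hx.symm)
  · have h := tensor_self_inner_grad hT (D.toSobolev u)
    have hdiv : (sphericalPart d).compLpL 2 D.measure (D.toSobolev u).1.snd = 0 := by
      refine Lp.ext ?_
      filter_upwards [(sphericalPart d).coeFn_compLpL (p := 2) (μ := D.measure)
        (D.toSobolev u).1.snd, u.2.2, Lp.coeFn_zero (Mat d) 2 D.measure] with x h1 h2 h3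
      rw [h1, h3]
      have h4 : ∑ i, (D.toSobolev u).1.snd x (i, i) = 0 := h2
      simp [sphericalPart, h4]
    rw [hdiv, inner_zero_right, add_zero] at h
    exact (mul_eq_zero.1 h).resolve_left two_ne_zero

theorem isClosed_solenoidal (D : FlowDomain d) : IsClosed (D.solenoidal : Set D.Pair) := by
  have h : (D.solenoidal : Set D.Pair) =
      (D.sobolev : Set D.Pair) ∩ {w : D.Pair | (matTrace d).compLpL 2 D.measure w.snd = 0} := by
    ext w
    refine and_congr_right fun _ => ?_
    have h1 := (matTrace d).coeFn_compLpL (p := 2) (μ := D.measure) w.snd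
    rw [mem_ofPred_eq, Lp.eq_zero_iff_ae_eq_zero]
    constructor
    · intro h2
      filter_upwards [h1, h2] with x hx1 hx2
      rw [hx1, matTrace_apply, hx2, Pi.zero_apply]
    · intro h2
      filter_upwards [h1, h2] with x hx1 hx2
      rw [← matTrace_apply, ← hx1, hx2, Pi.zero_apply]
  rw [h]
  refine IsClosed.inter (Submodule.isClosed_topologicalClosure _) (isClosed_eq ?_ continuous_const)
  exact ((matTrace d).compLpL 2 D.measure).continuous.comp (WithLp.continuous_snd 2 _ _)

instance completeSpace_H1 (D : FlowDomain d) : CompleteSpace D.H1 :=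
  D.isClosed_solenoidal.completeSpace_coe

end FlowDomain

/-! ### Nontriviality of the phase space. -/

theorem sum_classicalGrad_smul {f : Vec d → ℝ} {V : Vec d → Vec d} {x : Vec d}
    (hf : DifferentiableAt ℝ f x) (hV : DifferentiableAt ℝ V x) :
    ∑ i, classicalGrad (fun y => f y • V y) x (i, i) =
      fderiv ℝ f x (V x) + f x * ∑ i, classicalGrad V x (i, i) := by
  have h1 : V x = ∑ i, V x i • EuclideanSpace.single i (1 : ℝ) := by
    ext k
    simp [Finset.sum_apply, Pi.single_apply]
  have h2 : fderiv ℝ f x (V x) = ∑ i, V x i * fderiv ℝ f x (EuclideanSpace.single i 1) := by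
    conv_lhs => rw [h1]
    simp
  rw [h2, Finset.mul_sum, ← Finset.sum_add_distrib]
  refine Finset.sum_congr rfl fun i _ => ?_
  rw [classicalGrad_apply, fderiv_fun_smul hf hV, classicalGrad_apply]
  simp only [add_apply, smul_apply, ContinuousLinearMap.smulRight_apply, PiLp.add_apply,
    PiLp.smul_apply, smul_eq_mul]
  ring

/-- The infinitesimal rotation `x ↦ x_j e_i - x_i e_j`. -/
noncomputable def rotation (i j : Fin d) : Vec d →L[ℝ] Vec d :=
  (EuclideanSpace.proj (𝕜 := ℝ) j).smulRight (EuclideanSpace.single i 1) -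
    (EuclideanSpace.proj (𝕜 := ℝ) i).smulRight (EuclideanSpace.single j 1)

theorem rotation_apply (i j : Fin d) (x : Vec d) :
    rotation i j x = x j • EuclideanSpace.single i (1 : ℝ) - x i • EuclideanSpace.single j 1 := rfl

theorem inner_rotation_self (i j : Fin d) (x : Vec d) : inner ℝ x (rotation i j x) = 0 := by
  rw [rotation_apply, inner_sub_right, inner_smul_right, inner_smul_right,
    EuclideanSpace.inner_single_right, EuclideanSpace.inner_single_right]
  simp [mul_comm]

theorem trace_rotation {i j : Fin d} (hij : i ≠ j) (c x : Vec d) :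
    ∑ k, classicalGrad (fun y => rotation i j (y - c)) x (k, k) = 0 := by
  refine Finset.sum_eq_zero fun k _ => ?_
  have h : HasFDerivAt (fun y => rotation i j (y - c)) (rotation i j) x :=
    (rotation i j).hasFDerivAt.comp x ((hasFDerivAt_id x).sub_const c)
  rw [classicalGrad_apply, h.fderiv, rotation_apply]
  simp only [PiLp.sub_apply, PiLp.smul_apply, PiLp.single_apply, smul_eq_mul]
  rcases eq_or_ne k i with rfl | h1
  · simp [hij, hij.symm]
  · simp [h1, h1.symm]

namespace FlowDomain

variable {D : FlowDomain d}

theorem IsTestField.exists_field_ne_zero_of_divergence_free {φ : Vec d → Vec d}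
    (hφ : D.IsTestField φ)
    (hdiv : ∀ x, ∑ i, classicalGrad φ x (i, i) = 0) {x₀ : Vec d} (hx₀ : x₀ ∈ interior D.region)
    (hne : φ x₀ ≠ 0) : ∃ w : D.H1, field w ≠ 0 := by
  refine ⟨⟨hφ.pair, hφ.pair_mem_sobolev, ?_⟩, fun h => ?_⟩
  · filter_upwards [hφ.pair_snd_ae] with x hx
    rw [hx, hdiv]
  · have h2 : hφ.pair.fst = 0 := h
    have h3 : φ =ᵐ[D.measure] 0 :=
      hφ.pair_fst_ae.symm.trans ((Lp.eq_zero_iff_ae_eq_zero).1 h2)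
    have h4 : IsOpen (interior D.region ∩ {x | φ x ≠ 0}) :=
      isOpen_interior.inter (isOpen_ne_fun hφ.continuous continuous_const)
    refine (h4.measure_pos volume ⟨x₀, hx₀, hne⟩).ne' ?_
    refine measure_mono_null (t := D.region ∩ {x | φ x ≠ 0})
      (inter_subset_inter_left _ interior_subset) ?_
    have h5 := (ae_iff.1 h3)
    rw [measure, Measure.restrict_apply₀' D.measurableSet_region.nullMeasurableSet] at h5
    rw [inter_comm]
    exact h5

/-- On the torus the shear flow `sin(x_j) e_i` works. In an open set, multiply an infinitesimal
rotation about a point by a radial bump: the rotation is trace-free and tangent to the spheres on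
which the bump is constant. Without this the operator defining `λ₁` could be zero. -/
theorem exists_field_ne_zero (hd : 2 ≤ d) (D : FlowDomain d) : ∃ w : D.H1, field w ≠ 0 := by
  set i : Fin d := ⟨0, by omega⟩ with hi
  set j : Fin d := ⟨1, by omega⟩ with hj
  have hij : i ≠ j := by simp [hi, hj]
  cases D with
  | torus =>
    set φ : Vec d → Vec d := fun x => Real.sin (x j) • EuclideanSpace.single i 1 with hφdef
    have hsin : ContDiff ℝ ∞ fun x : Vec d => Real.sin (x j) :=
      Real.contDiff_sin.comp (EuclideanSpace.proj (𝕜 := ℝ) j).contDiff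
    have hper : ∀ x k, φ (x + EuclideanSpace.single k (2 * Real.pi)) = φ x := by
      intro x k
      simp only [hφdef, PiLp.add_apply, PiLp.single_apply]
      split_ifs
      · rw [Real.sin_add_two_pi]
      · rw [add_zero]
    have hφ : (torus : FlowDomain d).IsTestField φ := by
      refine ⟨hsin.smul contDiff_const, hper, ?_⟩
      -- Zero mean: a shift by `π` in the variable `x_j` reverses the sign of `φ` and preserves its
      -- integral.
      have h := integral_ambient_add (D := torus) hper (EuclideanSpace.single j Real.pi)
      have hneg : ∀ x, φ (x + EuclideanSpace.single j Real.pi) = -φ x := by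
        intro x
        simp only [hφdef, PiLp.add_apply, PiLp.single_apply, if_true, Real.sin_add_pi, neg_smul]
      simp only [hneg, integral_neg] at h
      have h2 : (2 : ℝ) • ∫ x, φ x ∂(torus : FlowDomain d).ambient = 0 := by
        rw [two_smul]
        nth_rewrite 1 [← h]
        exact neg_add_cancel _
      exact (smul_eq_zero.1 h2).resolve_left two_ne_zero
    refine hφ.exists_field_ne_zero_of_divergence_free (x₀ := WithLp.toLp 2 fun _ => Real.pi / 2)
      (fun x => ?_) ?_ ?_
    · rw [hφdef, sum_classicalGrad_smul (hsin.differentiable (by simp) x)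
        (differentiableAt_const _)]
      have h1 : HasFDerivAt (fun x : Vec d => Real.sin (x j))
          (Real.cos (x j) • EuclideanSpace.proj (𝕜 := ℝ) j) x :=
        HasDerivAt.comp_hasFDerivAt (f := fun x : Vec d => x j) x (Real.hasDerivAt_sin (x j))
          (EuclideanSpace.proj (𝕜 := ℝ) j).hasFDerivAt
      rw [h1.fderiv]
      simp [classicalGrad_apply, hij.symm]
    · refine mem_interior.2 ⟨{x : Vec d | ∀ k, x k ∈ Ioo (0 : ℝ) (2 * Real.pi)},
        fun x hx k => Ioo_subset_Ico_self (hx k), ?_, fun k => ?_⟩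
      · simp only [ofPred_forall]
        exact isOpen_iInter_of_finite fun k =>
          isOpen_Ioo.preimage (EuclideanSpace.proj (𝕜 := ℝ) k).continuous
      · constructor <;> simp only <;> linarith [Real.pi_pos]
    · intro h
      have := congrArg (fun v : Vec d => v i) h
      simp [hφdef] at this
  | dirichlet Ω h₁ h₂ h₃ =>
    obtain ⟨c, hc⟩ := h₃
    obtain ⟨r, hr, hrΩ⟩ := Metric.nhds_basis_closedBall.mem_iff.1 (h₁.mem_nhds hc)
    set f : Vec d → ℝ := fun x => expNegInvGlue (r ^ 2 - ‖x - c‖ ^ 2) with hf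
    have hg : ContDiff ℝ ∞ fun x : Vec d => r ^ 2 - ‖x - c‖ ^ 2 :=
      contDiff_const.sub ((contDiff_id.sub contDiff_const).norm_sq ℝ)
    have hfs : ContDiff ℝ ∞ f := expNegInvGlue.contDiff.comp hg
    have hVs : ContDiff ℝ ∞ fun x => rotation i j (x - c) :=
      (rotation i j).contDiff.comp (contDiff_id.sub contDiff_const)
    set φ : Vec d → Vec d := fun x => f x • rotation i j (x - c) with hφdef
    have hsupp : tsupport φ ⊆ Metric.closedBall c r := by
      refine closure_minimal (fun x hx => ?_) Metric.isClosed_closedBall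
      by_contra h
      refine hx ?_
      have h1 : r < ‖x - c‖ := by simpa [dist_eq_norm] using h
      have h2 : r ^ 2 - ‖x - c‖ ^ 2 ≤ 0 := by nlinarith
      simp only [hφdef, hf, expNegInvGlue.zero_of_nonpos h2, zero_smul]
    have hφ : (dirichlet Ω h₁ h₂ ⟨c, hc⟩).IsTestField φ :=
      ⟨hfs.smul hVs, (isCompact_closedBall c r).of_isClosed_subset (isClosed_tsupport _) hsupp,
        hsupp.trans hrΩ⟩
    refine hφ.exists_field_ne_zero_of_divergence_free
      (x₀ := c + EuclideanSpace.single i (r / 2)) (fun x => ?_) ?_ ?_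
    · rw [hφdef, sum_classicalGrad_smul (hfs.differentiable (by simp) x)
        (hVs.differentiable (by simp) x), trace_rotation hij, mul_zero, add_zero]
      have h1 : HasFDerivAt (fun x : Vec d => r ^ 2 - ‖x - c‖ ^ 2)
          (-(2 • (innerSL ℝ (x - c)).comp (ContinuousLinearMap.id ℝ (Vec d)))) x :=
        (((hasFDerivAt_id x).sub_const c).norm_sq).const_sub _
      have h2 := ((expNegInvGlue.contDiff (n := 1)).differentiable one_ne_zero
        (r ^ 2 - ‖x - c‖ ^ 2)).hasDerivAt.comp_hasFDerivAt x h1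
      have h3 : fderiv ℝ f x = _ := h2.fderiv
      rw [h3]
      simp only [smul_apply, neg_apply, ContinuousLinearMap.comp_apply, innerSL_apply_apply,
        ContinuousLinearMap.id_apply, inner_rotation_self, smul_zero, neg_zero]
    · change _ ∈ interior Ω
      rw [h₁.interior_eq]
      refine hrΩ ?_
      rw [mem_closedBall_iff_norm, add_sub_cancel_left, PiLp.norm_single,
        Real.norm_of_nonneg (by positivity)]
      linarith
    · intro h
      rw [hφdef] at h
      simp only [add_sub_cancel_left, hf, PiLp.norm_single, smul_eq_zero] at h
      rcases h with h | h
      · refine (expNegInvGlue.pos_of_pos ?_).ne' h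
        rw [Real.norm_of_nonneg (by positivity)]
        nlinarith
      · have := congrArg (fun v : Vec d => v j) h
        simp [rotation_apply, hij.symm, hr.ne'] at this

end FlowDomain

/-! ### The first Stokes eigenvalue, and the Lipschitz estimate for quadratic fields. -/

theorem exists_eigenvector_max_of_isCompactOperator {E : Type*} [NormedAddCommGroup E]
    [InnerProductSpace ℝ E] [CompleteSpace E] {T : E →L[ℝ] E} (hT : IsCompactOperator T)
    (hpos : T.IsPositive) (hne : T ≠ 0) :
    ∃ k : ℝ, 0 < k ∧ (∀ v, inner ℝ (T v) v ≤ k * ‖v‖ ^ 2) ∧ ∃ w : E, w ≠ 0 ∧ T w = k • w := by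
  -- For a self-adjoint operator the norm is the spectral radius, so some spectral value `k` has
  -- `|k| = ‖T‖ ≠ 0`. Compactness makes it an eigenvalue and positivity fixes its sign.
  have hr : spectralRadius ℝ T = ‖T‖₊ := T.spectralRadius_eq_nnnorm hpos.isSelfAdjoint
  have hnon : (spectrum ℝ T).Nonempty := by
    by_contra h
    rw [not_nonempty_iff_eq_empty] at h
    rw [spectralRadius, h] at hr
    simp at hr
    exact hne (nnnorm_eq_zero.1 hr.symm)
  obtain ⟨k, hk, hkr⟩ := spectrum.exists_nnnorm_eq_spectralRadius_of_nonempty hnon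
  rw [hr, ENNReal.coe_inj] at hkr
  have hk1 : ‖k‖ = ‖T‖ := congrArg NNReal.toReal hkr
  have hk0 : k ≠ 0 := by
    rw [← norm_ne_zero_iff, hk1]
    exact norm_ne_zero_iff.2 hne
  obtain ⟨w, hw⟩ := ((hT.hasEigenvalue_iff_mem_spectrum hk0).2 hk).exists_hasEigenvector
  have hTw : T w = k • w := hw.apply_eq_smul
  have h1 : 0 ≤ k * ‖w‖ ^ 2 := by
    have := hpos.inner_nonneg_left w
    rwa [hTw, real_inner_smul_left, real_inner_self_eq_norm_sq] at this
  have h2 : 0 ≤ k := nonneg_of_mul_nonneg_left h1 (pow_pos (norm_pos_iff.2 hw.2) 2)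
  refine ⟨k, h2.lt_of_ne' hk0, fun v => ?_, w, hw.2, hTw⟩
  calc inner ℝ (T v) v ≤ ‖T v‖ * ‖v‖ := real_inner_le_norm _ _
    _ ≤ (‖T‖ * ‖v‖) * ‖v‖ := by gcongr; exact T.le_opNorm v
    _ = k * ‖v‖ ^ 2 := by rw [← hk1, Real.norm_of_nonneg h2]; ring

theorem exists_norm_le_mul_norm_mul_norm {E F G : Type*} [SeminormedAddCommGroup E]
    [SeminormedAddCommGroup F] [SeminormedAddCommGroup G] [NormedSpace ℝ E] [NormedSpace ℝ F]
    [NormedSpace ℝ G] (T : E →L[ℝ] F →L[ℝ] G) :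
    ∃ C, 0 ≤ C ∧ ∀ u v, ‖T u v‖ ≤ C * ‖u‖ * ‖v‖ :=
  ⟨‖T‖, T.opNorm_nonneg, T.le_opNorm₂⟩

theorem exists_lipschitzOnWith_sub_adjoint {H K : Type*} [NormedAddCommGroup H]
    [InnerProductSpace ℝ H] [CompleteSpace H] [NormedAddCommGroup K] [InnerProductSpace ℝ K]
    [CompleteSpace K] (f : H) (L Q : H →L[ℝ] H) (G : H →L[ℝ] K) (T : H →L[ℝ] H →L[ℝ] K) (R : ℝ) :
    ∃ C : ℝ≥0, LipschitzOnWith C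
      (fun u => f - L u - Q (ContinuousLinearMap.adjoint (T u) (G u))) (Metric.closedBall 0 R) := by
  set C : ℝ := ‖L‖ + ‖Q‖ * (2 * (‖T‖ * |R| * ‖G‖)) with hC
  have hC0 : 0 ≤ C := by positivity
  refine ⟨C.toNNReal, LipschitzOnWith.of_dist_le_mul fun u hu v hv => ?_⟩
  rw [Real.coe_toNNReal C hC0, dist_eq_norm, dist_eq_norm]
  have hu' : ‖u‖ ≤ |R| := (mem_closedBall_zero_iff.1 hu).trans (le_abs_self R)
  have hv' : ‖v‖ ≤ |R| := (mem_closedBall_zero_iff.1 hv).trans (le_abs_self R)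
  -- Polarization of the quadratic term: the increment is split so that each piece is linear in `u -
  -- v`.
  have hsplit : f - L u - Q (ContinuousLinearMap.adjoint (T u) (G u)) -
      (f - L v - Q (ContinuousLinearMap.adjoint (T v) (G v))) = -L (u - v) -
        Q (ContinuousLinearMap.adjoint (T u) (G (u - v)) +
          ContinuousLinearMap.adjoint (T (u - v)) (G v)) := by
    simp only [map_sub, map_add, sub_apply]
    abel
  have hadj : ∀ u' x, ‖ContinuousLinearMap.adjoint (T u') x‖ ≤ ‖T‖ * ‖u'‖ * ‖x‖ := fun u' x => by
    refine (ContinuousLinearMap.le_opNorm _ x).trans ?_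
    rw [LinearIsometryEquiv.norm_map]
    gcongr
    exact T.le_opNorm u'
  have h1 : ‖ContinuousLinearMap.adjoint (T u) (G (u - v))‖ ≤ ‖T‖ * |R| * ‖G‖ * ‖u - v‖ := by
    refine (hadj _ _).trans ?_
    rw [mul_assoc _ ‖G‖]
    gcongr
    exact G.le_opNorm _
  have h2 : ‖ContinuousLinearMap.adjoint (T (u - v)) (G v)‖ ≤ ‖T‖ * |R| * ‖G‖ * ‖u - v‖ := by
    refine (hadj _ _).trans ?_
    calc ‖T‖ * ‖u - v‖ * ‖G v‖ ≤ ‖T‖ * ‖u - v‖ * (‖G‖ * |R|) := by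
          gcongr
          exact (G.le_opNorm _).trans (by gcongr)
      _ = _ := by ring
  rw [hsplit]
  calc _ ≤ ‖L‖ * ‖u - v‖ + ‖Q‖ * (‖T‖ * |R| * ‖G‖ * ‖u - v‖ + ‖T‖ * |R| * ‖G‖ * ‖u - v‖) := by
        refine (norm_sub_le _ _).trans (add_le_add ?_ ?_)
        · rw [norm_neg]
          exact L.le_opNorm _
        · refine (Q.le_opNorm _).trans ?_
          gcongr
          exact (norm_add_le _ _).trans (add_le_add h1 h2)
    _ = C * ‖u - v‖ := by rw [hC]; ring

namespace FlowDomain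

variable {D : FlowDomain d}

/-- The map `u ↦ u` from `𝐇¹` to `L²`. -/
noncomputable def fieldL (D : FlowDomain d) : D.H1 →L[ℝ] D.L2 := D.sobolevToL2.comp D.toSobolev

/-- The map `u ↦ ∇u` from `𝐇¹` to `L²`. -/
noncomputable def gradL (D : FlowDomain d) : D.H1 →L[ℝ] Lp (Mat d) 2 D.measure :=
  (WithLp.sndL 2 ℝ D.L2 (Lp (Mat d) 2 D.measure)).comp D.solenoidal.subtypeL

@[simp]
theorem fieldL_apply (u : D.H1) : D.fieldL u = field u := rfl

@[simp]
theorem gradL_apply (u : D.H1) : D.gradL u = grad u := rfl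

theorem inner_H1 (u v : D.H1) :
    inner ℝ u v = inner ℝ (field u) (field v) + inner ℝ (grad u) (grad v) :=
  WithLp.prod_inner_apply (u : D.Pair) (v : D.Pair)

theorem norm_sq_H1 (u : D.H1) : ‖u‖ ^ 2 = ‖field u‖ ^ 2 + ‖grad u‖ ^ 2 :=
  WithLp.prod_norm_sq_eq_of_L2 (u : D.Pair)

/-- With `T = ι*ι`, `T w = k w` reads `(w,v) = k((w,v) + (∇w,∇v))`, so `w` is a Stokes eigenvector
for `(1 - k)/k`. The Rayleigh bound for `k` becomes the sharp Poincaré inequality, which puts every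
other eigenvalue above; positivity comes from `exists_poincare`. -/
theorem isLeast_lambda1 (hd : 2 ≤ d) (D : FlowDomain d) :
    IsLeast D.stokesEigenvalues D.lambda1 ∧ 0 < D.lambda1 ∧
      ∀ v : D.H1, D.lambda1 * ‖field v‖ ^ 2 ≤ ‖grad v‖ ^ 2 := by
  set T : D.H1 →L[ℝ] D.H1 := (ContinuousLinearMap.adjoint D.fieldL).comp D.fieldL with hT
  have hTinner : ∀ u v, inner ℝ (T u) v = inner ℝ (field u) (field v) := fun u v =>
    ContinuousLinearMap.adjoint_inner_left D.fieldL v (D.fieldL u)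
  have hfieldL : IsCompactOperator D.fieldL := D.isCompactOperator_sobolevToL2.comp_clm D.toSobolev
  have hcompact : IsCompactOperator T := hfieldL.clm_comp (ContinuousLinearMap.adjoint D.fieldL)
  have hpos : T.IsPositive := ContinuousLinearMap.isPositive_adjoint_comp_self _
  have hne : T ≠ 0 := by
    obtain ⟨w, hw⟩ := exists_field_ne_zero hd D
    intro h
    have := hTinner w w
    rw [h, zero_apply, inner_zero_left] at this
    exact hw (inner_self_eq_zero.1 this.symm)
  obtain ⟨k, hk0, hkT, w, hw0, hw⟩ :=
    exists_eigenvector_max_of_isCompactOperator hcompact hpos hne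
  have hbound : ∀ v : D.H1, ‖field v‖ ^ 2 ≤ k * (‖field v‖ ^ 2 + ‖grad v‖ ^ 2) := by
    intro v
    rw [← norm_sq_H1, ← real_inner_self_eq_norm_sq (field v), ← hTinner]
    exact hkT v
  have heig : ∀ v : D.H1, stokes w v = (1 - k) / k * inner ℝ (field w) (field v) := by
    intro v
    have h1 := hTinner w v
    rw [hw, real_inner_smul_left, inner_H1] at h1
    rw [stokes]
    field_simp
    linarith
  have hbound' : ∀ v : D.H1, (1 - k) / k * ‖field v‖ ^ 2 ≤ ‖grad v‖ ^ 2 := by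
    intro v
    rw [div_mul_eq_mul_div, div_le_iff₀ hk0]
    linarith [hbound v]
  have hfield : ∀ (l : ℝ) (v : D.H1), v ≠ 0 →
      (∀ v', stokes v v' = l * inner ℝ (field v) (field v')) →
      0 < ‖field v‖ ∧ ‖grad v‖ ^ 2 = l * ‖field v‖ ^ 2 := by
    intro l v hv h
    have h1 : ‖grad v‖ ^ 2 = l * ‖field v‖ ^ 2 := by
      simpa only [stokes, real_inner_self_eq_norm_sq] using h v
    refine ⟨norm_pos_iff.2 fun h0 => hv ?_, h1⟩
    have h2 := norm_sq_H1 v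
    rw [h1, h0, norm_zero] at h2
    simpa using h2
  have hleast : IsLeast D.stokesEigenvalues ((1 - k) / k) := by
    refine ⟨⟨w, hw0, heig⟩, ?_⟩
    rintro l ⟨v, hv, hl⟩
    obtain ⟨h1, h2⟩ := hfield l v hv hl
    have h3 := hbound' v
    rw [h2] at h3
    exact le_of_mul_le_mul_right h3 (pow_pos h1 2)
  have hlam : D.lambda1 = (1 - k) / k := hleast.csInf_eq
  rw [hlam]
  refine ⟨hleast, ?_, hbound'⟩
  obtain ⟨C, hC, hP⟩ := exists_poincare (by omega) D
  obtain ⟨h1, h2⟩ := hfield _ w hw0 heig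
  have h3 : 0 < ‖grad w‖ := pos_of_mul_pos_right (h1.trans_le (hP w w.2.1)) hC.le
  exact pos_of_mul_pos_left (h2 ▸ pow_pos h3 2) (by positivity)

/-! ### The equation as an ordinary differential equation in the phase space. -/

/-- The scalar product `(u,v)_α` as a continuous bilinear form. -/
noncomputable def alphaForm (D : FlowDomain d) (α : ℝ) : D.H1 →L[ℝ] D.H1 →L[ℝ] ℝ :=
  (innerSL ℝ).bilinearComp D.fieldL D.fieldL + α • (innerSL ℝ).bilinearComp D.gradL D.gradL

@[simp]
theorem alphaForm_apply (α : ℝ) (u v : D.H1) : D.alphaForm α u v = alphaInner α u v := rfl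

theorem alphaInner_comm (α : ℝ) (u v : D.H1) : alphaInner α u v = alphaInner α v u := by
  rw [alphaInner, alphaInner, real_inner_comm, real_inner_comm (grad v)]

theorem alphaInner_self (α : ℝ) (u : D.H1) :
    alphaInner α u u = ‖field u‖ ^ 2 + α * ‖grad u‖ ^ 2 := by
  rw [alphaInner, real_inner_self_eq_norm_sq, real_inner_self_eq_norm_sq]

theorem alphaNorm_sq {α : ℝ} (hα : 0 ≤ α) (u : D.H1) :
    alphaNorm α u ^ 2 = alphaInner α u u := by
  rw [alphaNorm, Real.sq_sqrt]
  rw [alphaInner_self]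
  positivity

theorem alphaInner_coercive (α : ℝ) (u : D.H1) :
    min 1 α * ‖u‖ ^ 2 ≤ alphaInner α u u := by
  rw [alphaInner_self, norm_sq_H1, mul_add]
  refine add_le_add ?_ ?_
  · exact mul_le_of_le_one_left (by positivity) (min_le_left _ _)
  · exact mul_le_mul_of_nonneg_right (min_le_right _ _) (by positivity)

theorem isCoercive_alphaForm {α : ℝ} (hα : 0 < α) : IsCoercive (D.alphaForm α) :=
  ⟨min 1 α, lt_min one_pos hα, fun u => by
    rw [mul_assoc, ← sq]; exact alphaInner_coercive α u⟩

/-- The operator `(1 + αA)⁻¹`, acting on functionals represented by elements of `𝐇¹`. -/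
noncomputable def resolvent {α : ℝ} (hα : 0 < α) (D : FlowDomain d) : D.H1 →L[ℝ] D.H1 :=
  (isCoercive_alphaForm (D := D) hα).continuousLinearEquivOfBilin.symm

theorem alphaInner_resolvent {α : ℝ} (hα : 0 < α) (f v : D.H1) :
    alphaInner α (D.resolvent hα f) v = inner ℝ f v := by
  have h := (isCoercive_alphaForm (D := D) hα).continuousLinearEquivOfBilin_apply
    (D.resolvent hα f) v
  rw [← alphaForm_apply, ← h, resolvent, ContinuousLinearEquiv.coe_coe,
    ContinuousLinearEquiv.apply_symm_apply]

theorem IsStokesResolvent.unique {α : ℝ} (hα : 0 < α) {f : D.H1 → ℝ} {w w' : D.H1}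
    (h : IsStokesResolvent α f w) (h' : IsStokesResolvent α f w') : w = w' := by
  have h0 : D.alphaForm α (w - w') (w - w') = 0 := by
    have h0 : ∀ v, D.alphaForm α (w - w') v = alphaInner α w v - alphaInner α w' v := fun v => by
      rw [map_sub (D.alphaForm α), sub_apply, alphaForm_apply, alphaForm_apply]
    rw [h0, h, h', sub_self]
  have h1 := alphaInner_coercive α (w - w')
  rw [← alphaForm_apply, h0] at h1
  have h2 : ‖w - w'‖ ^ 2 ≤ 0 := nonpos_of_mul_nonpos_right h1 (lt_min one_pos hα)
  rw [← sub_eq_zero, ← norm_eq_zero]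
  exact pow_eq_zero_iff two_ne_zero |>.1 (le_antisymm h2 (by positivity))

/-- The Navier-Stokes-Voight vector field
`u ↦ (1 + αA)⁻¹ g - ν A (1 + αA)⁻¹ u - (1 + αA)⁻¹ B(u,u)` on `𝐇¹`, where `T` is a bilinear map
representing `B` by `⟨B(u,w),v⟩ = (T(u,v), ∇w)`. -/
noncomputable def voightField {α : ℝ} (hα : 0 < α) (ν : ℝ) (g : D.L2)
    (T : D.H1 →L[ℝ] D.H1 →L[ℝ] Lp (Mat d) 2 D.measure) (u : D.H1) : D.H1 :=
  D.resolvent hα (ContinuousLinearMap.adjoint D.fieldL g)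
    - ν • D.resolvent hα (ContinuousLinearMap.adjoint D.gradL (grad u))
    - D.resolvent hα (ContinuousLinearMap.adjoint (T u) (grad u))

theorem alphaInner_voightField {α : ℝ} (hα : 0 < α) (ν : ℝ) (g : D.L2)
    (T : D.H1 →L[ℝ] D.H1 →L[ℝ] Lp (Mat d) 2 D.measure) (u v : D.H1) :
    alphaInner α (voightField hα ν g T u) v =
      inner ℝ g (field v) - ν * inner ℝ (grad u) (grad v) - inner ℝ (grad u) (T u v) := by
  rw [← alphaForm_apply, voightField]
  simp only [map_sub, map_smul, sub_apply, smul_apply, alphaForm_apply, alphaInner_resolvent,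
    ContinuousLinearMap.adjoint_inner_left, fieldL_apply, gradL_apply, smul_eq_mul]

/-- Coercivity makes resolvents unique, so the existentially quantified `a`, `b`, `f` must be the
ones built into `voightField`. -/
theorem isSolutionOn_iff {α : ℝ} (hα : 0 < α) {ν : ℝ} {g : D.L2}
    {T : D.H1 →L[ℝ] D.H1 →L[ℝ] Lp (Mat d) 2 D.measure}
    (hT : ∀ u w v, convection u w v = inner ℝ (T u v) (grad w)) {I : Set ℝ} {u : ℝ → D.H1} :
    IsSolutionOn α ν g I u ↔
      ∀ t ∈ I, HasDerivWithinAt u (voightField hα ν g T (u t)) I t := by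
  have ha : ∀ u : D.H1, IsStokesResolvent α (stokes u)
      (D.resolvent hα (ContinuousLinearMap.adjoint D.gradL (grad u))) := fun u v => by
    rw [alphaInner_resolvent, ContinuousLinearMap.adjoint_inner_left]; rfl
  have hb : ∀ u : D.H1, IsStokesResolvent α (convection u u)
      (D.resolvent hα (ContinuousLinearMap.adjoint (T u) (grad u))) := fun u v => by
    rw [alphaInner_resolvent, ContinuousLinearMap.adjoint_inner_left, hT, real_inner_comm]
  have hf : IsStokesResolvent α (force g)
      (D.resolvent hα (ContinuousLinearMap.adjoint D.fieldL g)) := fun v => by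
    rw [alphaInner_resolvent, ContinuousLinearMap.adjoint_inner_left]; rfl
  refine forall₂_congr fun t _ => ⟨?_, fun h => ?_⟩
  · rintro ⟨u', a, b, f, hu', ha', hb', hf', h⟩
    refine hu'.congr_deriv ?_
    rw [voightField, ← ha'.unique hα (ha _), ← hb'.unique hα (hb _), ← hf'.unique hα hf, ← h]
    abel
  · refine ⟨_, _, _, _, h, ha _, hb _, hf, ?_⟩
    rw [voightField]
    abel

theorem lipschitzOnWith_voightField {α : ℝ} (hα : 0 < α) (ν : ℝ) (g : D.L2)
    (T : D.H1 →L[ℝ] D.H1 →L[ℝ] Lp (Mat d) 2 D.measure) (R : ℝ) :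
    ∃ K : ℝ≥0, LipschitzOnWith K (voightField hα ν g T) (Metric.closedBall 0 R) :=
  exists_lipschitzOnWith_sub_adjoint _
    (ν • (D.resolvent hα).comp ((ContinuousLinearMap.adjoint D.gradL).comp D.gradL))
    (D.resolvent hα) D.gradL T R

/-- The cancellation removes convection, leaving `2(g,u) - 2ν‖∇u‖²`. Young's inequality and `λ₁‖u‖²
≤ ‖∇u‖²` spend one `ν‖∇u‖²` on the force; the other dominates `γ‖u‖_α²`, which is what fixes the
value of `γ`. -/
theorem voightField_dissipative (hd : 2 ≤ d) {α ν : ℝ} (hα : 0 < α) (hν : 0 < ν) (g : D.L2)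
    {T : D.H1 →L[ℝ] D.H1 →L[ℝ] Lp (Mat d) 2 D.measure}
    (hT : ∀ u, inner ℝ (T u u) (grad u) = 0) (u : D.H1) :
    2 * alphaInner α (voightField hα ν g T u) u ≤
      -(ν * D.lambda1 / (α * D.lambda1 + 1)) * alphaInner α u u + ‖g‖ ^ 2 / (ν * D.lambda1) := by
  obtain ⟨-, hl, hP⟩ := isLeast_lambda1 hd D
  set l := D.lambda1
  rw [alphaInner_voightField, real_inner_comm (T u u), hT, sub_zero, real_inner_self_eq_norm_sq,
    alphaInner_self]
  have h1 := real_inner_le_norm g (field u)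
  have h2 := hP u
  have h3 : 2 * (‖g‖ * ‖field u‖) ≤ ν * (l * ‖field u‖ ^ 2) + ‖g‖ ^ 2 / (ν * l) := by
    have h : 0 ≤ (ν * l * ‖field u‖ - ‖g‖) ^ 2 / (ν * l) := by positivity
    have h' : (ν * l * ‖field u‖ - ‖g‖) ^ 2 / (ν * l) =
        ν * (l * ‖field u‖ ^ 2) + ‖g‖ ^ 2 / (ν * l) - 2 * (‖g‖ * ‖field u‖) := by
      field_simp
      ring
    linarith
  have h4 : ν * l / (α * l + 1) * (‖field u‖ ^ 2 + α * ‖grad u‖ ^ 2) ≤ ν * ‖grad u‖ ^ 2 := by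
    rw [div_mul_eq_mul_div, div_le_iff₀ (by positivity)]
    have := mul_le_mul_of_nonneg_left h2 hν.le
    nlinarith
  have h5 := mul_le_mul_of_nonneg_left h2 hν.le
  linarith

end FlowDomain

end NSV

/-! ### Energy estimate, semigroup and absorbing set. -/

open NSV NSV.FlowDomain in
theorem mainTheorem11 {d : ℕ} (hd : d = 2 ∨ d = 3) (D : NSV.FlowDomain d)
    (α ν : ℝ) (hα : 0 < α) (hν : 0 < ν) (g : D.L2)
    (hg : NSV.FlowDomain.IsAdmissibleForce D g) :
    (IsLeast D.stokesEigenvalues D.lambda1 ∧ 0 < D.lambda1) ∧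
    (∀ T : ℝ, 0 < T → ∀ u : ℝ → D.H1,
      NSV.FlowDomain.IsSolutionOn α ν g (Icc 0 T) u → ∀ t ∈ Icc 0 T,
        NSV.FlowDomain.alphaNorm α (u t) ^ 2 ≤
          NSV.FlowDomain.alphaNorm α (u 0) ^ 2 *
              Real.exp (-(ν * D.lambda1 / (α * D.lambda1 + 1)) * t) +
            (α * D.lambda1 + 1) / (ν ^ 2 * D.lambda1 ^ 2) * ‖g‖ ^ 2 *
              (1 - Real.exp (-(ν * D.lambda1 / (α * D.lambda1 + 1)) * t))) ∧
    ∃ S : ℝ≥0 → D.H1 → D.H1,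
      NSV.FlowDomain.IsSolutionSemigroup α ν g S ∧ NSV.FlowDomain.IsDissipative S := by
  have hd2 : 2 ≤ d := by omega
  obtain ⟨hleast, hl, -⟩ := isLeast_lambda1 hd2 D
  obtain ⟨T, hT, hT0⟩ := exists_convection_tensor hd D
  set l := D.lambda1 with hldef
  set γ : ℝ := ν * l / (α * l + 1) with hγdef
  have hγ : 0 < γ := by positivity
  set F : D.H1 → D.H1 := voightField hα ν g T with hF
  have hsymm : ∀ u v, D.alphaForm α u v = D.alphaForm α v u := alphaInner_comm α
  have hdiss : ∀ u, 2 * D.alphaForm α (F u) u ≤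
      -γ * D.alphaForm α u u + ‖g‖ ^ 2 / (ν * l) := voightField_dissipative hd2 hα hν g hT0
  have hM : ‖g‖ ^ 2 / (ν * l) / γ = (α * l + 1) / (ν ^ 2 * l ^ 2) * ‖g‖ ^ 2 := by
    rw [hγdef]
    field_simp
  have henergy : ∀ (τ : ℝ) (u : ℝ → D.H1),
      (∀ t ∈ Icc 0 τ, HasDerivWithinAt u (F (u t)) (Icc 0 τ) t) →
      ∀ t ∈ Icc 0 τ, alphaInner α (u t) (u t) ≤ alphaInner α (u 0) (u 0) * Real.exp (-γ * t) +
        (α * l + 1) / (ν ^ 2 * l ^ 2) * ‖g‖ ^ 2 * (1 - Real.exp (-γ * t)) := by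
    intro τ u hu t ht
    rw [← hM]
    exact quadratic_le_of_dissipative (D.alphaForm α) hsymm hγ hdiss hu t ht
  refine ⟨⟨hleast, hl⟩, fun τ _ u hu t ht => ?_, ?_⟩
  · rw [alphaNorm_sq hα.le, alphaNorm_sq hα.le]
    exact henergy τ u ((isSolutionOn_iff hα hT).1 hu) t ht
  · obtain ⟨S, hS0, hSadd, hSsol, hSuniq⟩ := exists_semigroup_of_dissipative (D.alphaForm α) hsymm
      (lt_min one_pos hα) (alphaInner_coercive α) (lipschitzOnWith_voightField hα ν g T) hγ hdiss
    refine ⟨S, ⟨hS0, hSadd, fun u₀ => (isSolutionOn_iff hα hT).2 (hSsol u₀),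
      fun τ _ u hu => hSuniq τ u ((isSolutionOn_iff hα hT).1 hu)⟩, ?_⟩
    set M : ℝ := (α * l + 1) / (ν ^ 2 * l ^ 2) * ‖g‖ ^ 2 with hMdef
    have hM0 : 0 ≤ M := by positivity
    have hSenergy : ∀ (t : ℝ≥0) (u₀ : D.H1), alphaInner α (S t u₀) (S t u₀) ≤
        alphaInner α u₀ u₀ * Real.exp (-γ * t) + M := by
      intro t u₀
      have h := henergy t (fun r => S r.toNNReal u₀) (fun r hr =>
        (hSsol u₀ r hr.1).mono fun q hq => hq.1) t (right_mem_Icc.2 t.2)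
      simp only [Real.toNNReal_coe, Real.toNNReal_zero, hS0, id_eq] at h
      have h1 : M * (1 - Real.exp (-γ * t)) ≤ M :=
        mul_le_of_le_one_right hM0 (by linarith [Real.exp_pos (-γ * t)])
      linarith
    -- `M` is the limiting energy level of the estimate; the extra `1` absorbs the transient once
    -- `|a| * exp (-γ t) ≤ 1`, where `a` bounds the initial energy on `C`.
    refine ⟨{u | alphaInner α u u ≤ M + 1}, ?_, fun C hC => ?_⟩
    · refine (Metric.isBounded_closedBall (x := (0 : D.H1))
        (r := Real.sqrt ((M + 1) / min 1 α))).subset fun u hu => ?_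
      rw [mem_closedBall_zero_iff]
      apply Real.le_sqrt_of_sq_le
      rw [le_div_iff₀ (lt_min one_pos hα), mul_comm]
      exact (alphaInner_coercive α u).trans hu
    · obtain ⟨r, hr⟩ := hC.exists_norm_le
      obtain ⟨K, hK0, hK⟩ := exists_norm_le_mul_norm_mul_norm (D.alphaForm α)
      set a : ℝ := K * r * r with ha
      have hlim : Filter.Tendsto (fun t : ℝ≥0 => |a| * Real.exp (-γ * t)) Filter.atTop (nhds 0) := by
        have h1 : Filter.Tendsto (fun t : ℝ≥0 => γ * (t : ℝ)) Filter.atTop Filter.atTop :=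
          (NNReal.tendsto_coe_atTop.2 Filter.tendsto_id).const_mul_atTop hγ
        have h2 := (Real.tendsto_exp_neg_atTop_nhds_zero.comp h1).const_mul |a|
        simpa [Function.comp_def] using h2
      obtain ⟨τ, hτ⟩ := Filter.eventually_atTop.1 (hlim.eventually_le_const one_pos)
      refine ⟨τ, fun t ht => ?_⟩
      rintro _ ⟨u₀, hu₀, rfl⟩
      have h1 : alphaInner α u₀ u₀ ≤ |a| := by
        refine le_trans ?_ (le_abs_self a)
        refine (le_abs_self _).trans ((hK u₀ u₀).trans ?_)
        have := hr u₀ hu₀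
        have h0 : 0 ≤ r := (norm_nonneg _).trans this
        rw [ha]
        gcongr
      have h2 := mul_le_mul_of_nonneg_right h1 (Real.exp_pos (-γ * t)).le
      have h3 := hSenergy t u₀
      have h4 := hτ t ht
      change alphaInner α (S t u₀) (S t u₀) ≤ M + 1
      linarith
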